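/- Let $k$ be a field, $q\in k$ nonzero, $n$ a positive integer, and put $\widehat q=q-q^{-1}$. Let $A=\mathcal O_q(M_n(k))$ be the $k$-algebra with generators $X_{ij}$ ($1\le i,j\le n$) and the relations $$\sum_{s,t=1}^n R^{ij}_{st}X_{sl}X_{tm}=\sum_{s,t=1}^n R^{st}_{lm}X_{jt}X_{is}\qquad(1\le i,j,l,m\le n),$$ where $R^{ii}_{ii}=q$ for all $i$, $R^{ij}_{ij}=1$ for $i\ne j$, $R^{ij}_{ji}=\widehat q$ for $i>j$, and $R^{ij}_{lm}=0$ otherwise. (Equivalently: $X_{ij}X_{lj}=qX_{lj}X_{ij}$ for $i<l$; $X_{ij}X_{im}=qX_{im}X_{ij}$ for $j<m$; $X_{ij}X_{lm}=X_{lm}X_{ij}$ for $i<l$, $j>m$; $X_{ij}X_{lm}-X_{lm}X_{ij}=\widehat q\,X_{im}X_{lj}$ for $i<l$, $j<m$.) For $I=\{i_1<\dots<i_t\}$ and $J=\{j_1<\dots<j_t\}$ in $\{1,\dots,n\}$, the quantum minor with row set $I$ and column set $J$ is $$[I|J]=\sum_{\sigma\in S_t}(-q)^{\ell(\sigma)}X_{i_{\sigma(1)},j_1}\cdots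 X_{i_{\sigma(t)},j_t},$$ where $\ell(\sigma)$ is the number of inversions of $\sigma$. For such $I,J$ write $I\le J$ if $i_l\le j_l$ for all $l$, and $I<J$ if moreover $I\neq J$. For $S,T\subseteq\{1,\dots,n\}$ let $\ell(S;T)=|\{(s,t)\in S\times T: s>t\}|$. For $X,Y\subseteq\{1,\dots,n\}$ let $$\mathcal S_<(X,Y)=\{S\subseteq X\cup Y: X\cap Y\subseteq S,\ |S|=|X|,\ S<X\},$$ $$\mathcal S_>(X,Y)=\{S\subseteq X\cup Y: X\cap Y\subseteq S,\ |S|=|X|,\ S>X\}.$$ For $S$ in either family put $S^\natural=S^\natural_{X,Y}=(X\cap Y)\sqcup\bigl((X\cup Y)\setminus S\bigr)$, so that $|S^\natural|=|Y|$. For $S\in\mathcal S_<(X,Y)$ and $T\in\mathcal S_>(X,Y)$ set $$\mathcal L(S,X,Y)=\ell\bigl((S\setminus S^\natural)\cup(Y\setminus X);X\setminus S\bigr)-\ell\bigl((S\setminus S^\natural)\cup(Y\setminus X);S\setminus X\bigr),$$ $$\mathcal L^\natural(T,X,Y)=\ell\bigl((T^\natural\setminus T)\cup(X\setminus Y);T\setminus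 X\bigr)-\ell\bigl((T^\natural\setminus T)\cup(X\setminus Y);X\setminus T\bigr).$$ For $d\in\mathbb N$ let $[d]_{-q}=(-q)^{d-1}+(-q)^{d-3}+\dots+(-q)^{-(d-1)}$. For $I=\{r_1<\dots<r_m\}\ge J$ let $\xi_q(I;J)=[d_1]_{-q}\cdots[d_m]_{-q}$, where $d_l=|\{j\in J: j\le r_l\}|-l+1\ge 1$, and $\xi_q(\varnothing;\varnothing)=1$. **Corollary 5.7.** Let $I,J,M,N\subseteq\{1,\dots,n\}$ with $|I|=|J|$ and $|M|=|N|$. Then in $A$ $$q^{|I\cap M|}[I|J][M|N]+q^{|I\cap M|}\sum_{S\in\mathcal S_>(J,N)}\widetilde\mu_S\,[I|S][M|S^\natural]=q^{|J\cap N|}[M|N][I|J]+q^{|J\cap N|}\sum_{T\in\mathcal S_<(I,M)}\widetilde\lambda_T\,[T^\natural|N][T|J],$$ where $S^\natural=S^\natural_{J,N}$, $T^\natural=T^\natural_{I,M}$, and $$\widetilde\mu_S=(-\widehat q)^{|S\setminus J|}(-q)^{-\mathcal L^\natural(S,J,N)}\,\xi_q(S\setminus J;J\setminus S),\qquad \widetilde\lambda_T=(-\widehat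 q)^{|I\setminus T|}(-q)^{-\mathcal L(T,I,M)}\,\xi_q(I\setminus T;T\setminus I).$$ -/

import Mathlib

open scoped BigOperators

namespace QuantumMatrices

/-- The scalar `q - q⁻¹`. -/
def qHat {k : Type*} [Field k] (q : k) : k := q - q⁻¹

/-- The entry `R^{ij}_{lm}` of the standard R-matrix of type `A_{n-1}`: it is `q` if all four
indices agree, `R^{ij}_{ij} = 1` for `i ≠ j`, `R^{ij}_{ji} = q - q⁻¹` for `i > j`, and all other
entries vanish. -/
def rMatrix {k : Type*} [Field k] {n : ℕ} (q : k) (i j l m : Fin n) : k :=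
  if i = j ∧ l = i ∧ m = i then q
  else if l = i ∧ m = j then 1
  else if j < i ∧ l = j ∧ m = i then qHat q
  else 0

/-- The Faddeev-Reshetikhin-Takhtadzhyan relations
`∑_{s,t} R^{ij}_{st} X_{sl} X_{tm} = ∑_{s,t} R^{st}_{lm} X_{jt} X_{is}` on the free algebra on the
letters `X_{ij}`. -/
inductive FRTRel {k : Type*} [Field k] (n : ℕ) (q : k) :
    FreeAlgebra k (Fin n × Fin n) → FreeAlgebra k (Fin n × Fin n) → Prop
  | mk (i j l m : Fin n) : FRTRel n q
      (∑ s : Fin n, ∑ t : Fin n,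
        rMatrix q i j s t • (FreeAlgebra.ι k (s, l) * FreeAlgebra.ι k (t, m)))
      (∑ s : Fin n, ∑ t : Fin n,
        rMatrix q s t l m • (FreeAlgebra.ι k (j, t) * FreeAlgebra.ι k (i, s)))

/-- The quantized coordinate ring `O_q(M_n(k))` of `n × n` matrices. -/
abbrev OqM {k : Type*} [Field k] (n : ℕ) (q : k) : Type _ := RingQuot (FRTRel n q)

/-- The standard generators `X_{ij}` of `O_q(M_n(k))`. -/
def gen {k : Type*} [Field k] {n : ℕ} (q : k) (i j : Fin n) : OqM n q :=
  RingQuot.mkAlgHom k (FRTRel n q) (FreeAlgebra.ι k (i, j))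

/-- The length of a permutation, as its number of inversions. -/
def permLength {t : ℕ} (σ : Equiv.Perm (Fin t)) : ℕ :=
  (Finset.univ.filter fun p : Fin t × Fin t => p.1 < p.2 ∧ σ p.2 < σ p.1).card

/-- The quantum minor `[I|J]`. With `I = {i_1 < ⋯ < i_t}` and `J = {j_1 < ⋯ < j_t}`, it is
`∑_{σ ∈ S_t} (-q)^{ℓ(σ)} X_{i_{σ(1)}, j_1} ⋯ X_{i_{σ(t)}, j_t}`, the factors being multiplied in
this order. Quantum minors are considered only for `|I| = |J|`; the value `0` in the other case
is a dummy. -/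
def minor {k : Type*} [Field k] {n : ℕ} (q : k) (I J : Finset (Fin n)) : OqM n q :=
  if h : J.card = I.card then
    ∑ σ : Equiv.Perm (Fin I.card),
      (-q) ^ permLength σ •
        (List.ofFn fun a : Fin I.card =>
          gen q (I.orderEmbOfFin rfl (σ a)) (J.orderEmbOfFin h a)).prod
  else 0

/-- `ℓ(S;T)`, the number of pairs `(s,t) ∈ S × T` with `s > t`. -/
def ell {n : ℕ} (S T : Finset (Fin n)) : ℕ :=
  ((S ×ˢ T).filter fun p => p.2 < p.1).card

/-- The partial order on index sets of the same cardinality: `{i_1 < ⋯ < i_t} ≤ {j_1 < ⋯ < j_t}`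
if and only if `i_l ≤ j_l` for all `l`. -/
def IndexLE {n : ℕ} (I J : Finset (Fin n)) : Prop :=
  ∃ h : I.card = J.card, ∀ l : Fin J.card, I.orderEmbOfFin h l ≤ J.orderEmbOfFin rfl l

/-- The strict order associated with `IndexLE`. -/
def IndexLT {n : ℕ} (I J : Finset (Fin n)) : Prop := IndexLE I J ∧ I ≠ J

open Classical in
/-- The family of all `S ⊆ X ∪ Y` with `X ∩ Y ⊆ S`, `|S| = |X|` and `S < X`. -/
noncomputable def lowerSets {n : ℕ} (X Y : Finset (Fin n)) : Finset (Finset (Fin n)) :=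
  (X ∪ Y).powerset.filter fun S => X ∩ Y ⊆ S ∧ S.card = X.card ∧ IndexLT S X

open Classical in
/-- The family of all `T ⊆ X ∪ Y` with `X ∩ Y ⊆ T`, `|T| = |X|` and `T > X`. -/
noncomputable def upperSets {n : ℕ} (X Y : Finset (Fin n)) : Finset (Finset (Fin n)) :=
  (X ∪ Y).powerset.filter fun T => X ∩ Y ⊆ T ∧ T.card = X.card ∧ IndexLT X T

/-- `S^♮ = (X ∩ Y) ⊔ ((X ∪ Y) \ S)`. -/
def natural {n : ℕ} (X Y S : Finset (Fin n)) : Finset (Fin n) := (X ∩ Y) ∪ ((X ∪ Y) \ S)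

/-- The exponent `𝓛(S,X,Y)`. -/
def expL {n : ℕ} (S X Y : Finset (Fin n)) : ℤ :=
  (ell ((S \ natural X Y S) ∪ (Y \ X)) (X \ S) : ℤ)
    - (ell ((S \ natural X Y S) ∪ (Y \ X)) (S \ X) : ℤ)

/-- The exponent `𝓛^♮(T,X,Y)`. -/
def expLNat {n : ℕ} (T X Y : Finset (Fin n)) : ℤ :=
  (ell ((natural X Y T \ T) ∪ (X \ Y)) (T \ X) : ℤ)
    - (ell ((natural X Y T \ T) ∪ (X \ Y)) (X \ T) : ℤ)

/-- The `(-q)`-integer `[d]_{-q} = (-q)^{d-1} + (-q)^{d-3} + ⋯ + (-q)^{-(d-1)}`. -/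
def negQInt {k : Type*} [Field k] (q : k) (d : ℕ) : k :=
  ∑ i ∈ Finset.range d, (-q) ^ ((d : ℤ) - 1 - 2 * (i : ℤ))

/-- `ξ_q(I;J) = [d_1]_{-q} ⋯ [d_m]_{-q}` for `I = {r_1 < ⋯ < r_m} ≥ J`, where
`d_l = |[1,r_l] ∩ J| - (l - 1)`; here `l - 1` is written as the number of elements of `I` below
`r_l`. When `I ≥ J`, all `d_l` are at least `1`, so the subtraction is not truncated. -/
def xi {k : Type*} [Field k] {n : ℕ} (q : k) (I J : Finset (Fin n)) : k :=
  ∏ r ∈ I, negQInt q ((J.filter fun j => j ≤ r).card - (I.filter fun i => i < r).card)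

/-- The coefficient
`μ̃_S = (-(q - q⁻¹))^{|S \ X|} (-q)^{-𝓛^♮(S,X,Y)} ξ_q(S \ X; X \ S)`. -/
def muTilde {k : Type*} [Field k] {n : ℕ} (q : k) (X Y S : Finset (Fin n)) : k :=
  (-qHat q) ^ (S \ X).card * (-q) ^ (-expLNat S X Y) * xi q (S \ X) (X \ S)

/-- The coefficient
`λ̃_T = (-(q - q⁻¹))^{|X \ T|} (-q)^{-𝓛(T,X,Y)} ξ_q(X \ T; T \ X)`. -/
def lambdaTilde {k : Type*} [Field k] {n : ℕ} (q : k) (X Y T : Finset (Fin n)) : k :=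
  (-qHat q) ^ (X \ T).card * (-q) ^ (-expL T X Y) * xi q (X \ T) (T \ X)

end QuantumMatrices

namespace QuantumMatrices

/-! Let `e_1, …, e_n` generate the quantum exterior algebra, with `e_x² = 0` and `e_y e_x = -q e_x
e_y` for `x < y`, and let `η_j = ∑ e_x X_{xj}`. The FRT relations make the `η_j` satisfy the same
relations, and `[T|J]` is the coefficient of the ordered monomial `e_T` in the ordered product of
the `η_j`, `j ∈ J`. Minors are thus matrix coefficients of the coaction on the exterior algebra. The
braiding of that algebra with itself commutes with the coaction; written in coordinates, this is a
relation between `[I|S][M|S']` and `[T'|N][T|J]`, and it is the theorem up to normalization.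

The braiding is built in three stages: `braid` (the inverse of the R-matrix) on two vectors,
`vecBraid` on a vector and a monomial, `minorBraid` on two monomials. Each stage is compatible with
multiplication by a vector (`vecBraid_mulCoeff`, `minorBraid_mulCoeff`), so the commutation
relations pass from generators (`braid_gen`) to a minor and a generator (`vecBraid_minor_gen`) and
then to two minors (`minorBraid_minor_minor`), by induction on the number of columns.

The coefficients of `minorBraid` have a closed form: a product of site weights along the lattice
path that goes up at elements of `J` and down at elements of `S`. A down-step from height `h` weighs
`(-q)^h - (-q)^(-h)`, which vanishes at `h = 0`; hence only `S ≥ J` survive. The coefficient for `S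
= J` is `q^(-|J ∩ N|)`, and multiplying by `q^|J ∩ N|` turns the others into `muTilde`. Exchanging
the roles of the sets turns the coefficients on the row side into `lambdaTilde`. -/

variable {k : Type*} [Field k] {n : ℕ} {q : k}

/-! ### Relations between generators. -/

/-- The defining relations, written out. -/
theorem gen_frt (q : k) (i j l m : Fin n) :
    (if i = j then q else 1) • (gen q i l * gen q j m)
      + (if j < i then qHat q else 0) • (gen q j l * gen q i m)
    = (if l = m then q else 1) • (gen q j m * gen q i l)
      + (if l < m then qHat q else 0) • (gen q j l * gen q i m) := by
  have h := RingQuot.mkAlgHom_rel k (FRTRel.mk (n := n) (q := q) i j l m)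
  simp only [map_sum, map_smul, map_mul] at h
  change ∑ s, ∑ t, rMatrix q i j s t • (gen q s l * gen q t m)
    = ∑ s, ∑ t, rMatrix q s t l m • (gen q j t * gen q i s) at h
  have hR : ∀ a b c d : Fin n, rMatrix q a b c d
      = (if c = a ∧ d = b then (if a = b then q else 1) else 0)
        + (if c = b ∧ d = a then (if b < a then qHat q else 0) else 0) := by
    intro a b c d
    unfold rMatrix
    grind
  have e1 : ∀ s t, rMatrix q s t l m
      = (if s = l ∧ t = m then (if l = m then q else 1) else 0)
        + (if s = m ∧ t = l then (if l < m then qHat q else 0) else 0) := by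
    intro s t
    rw [hR]
    grind
  simp only [e1] at h
  simp only [hR, add_smul, Finset.sum_add_distrib, ite_and, ite_smul, zero_smul,
    Finset.sum_ite_eq', Finset.sum_ite_irrel, Finset.sum_const_zero, Finset.mem_univ, if_true] at h
  simpa only [ite_smul, zero_smul] using h

theorem gen_col_of_lt {a b : Fin n} (hab : a < b) (i : Fin n) :
    gen q a i * gen q b i = q • (gen q b i * gen q a i) := by
  have h := gen_frt q a b i i
  simpa [hab.ne, hab.not_gt] using h

theorem gen_comm_of_lt {a b i j : Fin n} (hab : a < b) (hij : i < j) :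
    gen q a j * gen q b i = gen q b i * gen q a j := by
  have h := gen_frt q a b j i
  simpa [hab.ne, hab.not_gt, hij.ne', hij.not_gt] using h

theorem gen_cross_of_lt {a b i j : Fin n} (hab : a < b) (hij : i < j) :
    gen q a i * gen q b j = gen q b j * gen q a i + qHat q • (gen q b i * gen q a j) := by
  have h := gen_frt q a b i j
  simpa [hab.ne, hab.not_gt, hij.ne, hij] using h

/-! ### Expansion of a minor along its first column. -/

/-- The number of elements of `T` below `x`. -/
def below (T : Finset (Fin n)) (x : Fin n) : ℕ := (T.filter (· < x)).card

/-- Number of inversions of a map. -/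
def inversions {t : ℕ} (g : Fin t → Fin n) : ℕ :=
  (Finset.univ.filter fun p : Fin t × Fin t => p.1 < p.2 ∧ g p.2 < g p.1).card

theorem minor_eq_zero {I J : Finset (Fin n)} (h : J.card ≠ I.card) : minor q I J = 0 :=
  dif_neg h

/-- Summing over maps into `Fin n` with prescribed image, rather than over permutations, lets the
first value be split off with `Fin.cons` without relabelling the remaining rows. -/
theorem minor_eq_sum_fun {t : ℕ} {I J : Finset (Fin n)} (hI : I.card = t) (hJ : J.card = t) :
    minor q I J = ∑ g : Fin t → Fin n with Finset.univ.image g = I,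
      (-q) ^ inversions g • (List.ofFn fun a => gen q (g a) (J.orderEmbOfFin hJ a)).prod := by
  subst hI
  rw [minor, dif_pos hJ]
  refine Finset.sum_bij (fun σ _ a => I.orderEmbOfFin rfl (σ a)) ?_ ?_ ?_ ?_
  · intro σ _
    simp only [Finset.mem_filter, Finset.mem_univ, true_and]
    have : (fun a => I.orderEmbOfFin rfl (σ a)) = I.orderEmbOfFin rfl ∘ σ := rfl
    rw [this, ← Finset.image_image, Finset.image_univ_equiv, Finset.image_orderEmbOfFin_univ]
  · intro σ _ τ _ h
    refine Equiv.ext fun a => ?_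
    simpa using congrFun h a
  · intro g hg
    simp only [Finset.mem_filter, Finset.mem_univ, true_and] at hg
    have hmem : ∀ a, g a ∈ I := fun a => hg ▸ Finset.mem_image_of_mem g (Finset.mem_univ a)
    have hinj : Function.Injective g := by
      refine Set.injOn_univ.mp ?_
      rw [← Finset.coe_univ, ← Finset.card_image_iff, hg, Finset.card_univ, Fintype.card_fin]
    have hs : Function.Injective
        (fun a => (I.orderIsoOfFin rfl).symm ⟨g a, hmem a⟩) := by
      intro a b h
      apply hinj
      simpa using h
    refine ⟨Equiv.ofBijective _ (Finite.injective_iff_bijective.mp hs), Finset.mem_univ _, ?_⟩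
    funext a
    simp [← Finset.coe_orderIsoOfFin_apply]
  · intro σ _
    congr 2
    simp [permLength, inversions]

theorem inversions_cons {t : ℕ} (x : Fin n) (g : Fin t → Fin n) :
    inversions (Fin.cons x g : Fin (t + 1) → Fin n)
      = (Finset.univ.filter fun a => g a < x).card + inversions g := by
  unfold inversions
  simp only [Finset.card_filter, ← Finset.univ_product_univ, Finset.sum_product,
    Fin.sum_univ_succ, Fin.cons_zero, Fin.cons_succ]
  simp

theorem orderEmbOfFin_insert {t : ℕ} {i : Fin n} {J : Finset (Fin n)} (hi : ∀ j ∈ J, i < j)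
    (hJ : J.card = t) (hJ' : (insert i J).card = t + 1) :
    ((insert i J).orderEmbOfFin hJ' : Fin (t + 1) → Fin n)
      = Fin.cons i (J.orderEmbOfFin hJ) := by
  symm
  apply Finset.orderEmbOfFin_unique
  · intro x
    refine Fin.cases ?_ (fun y => ?_) x
    · simp
    · simp
  · intro a b hab
    induction a using Fin.cases with
    | zero =>
      induction b using Fin.cases with
      | zero => exact absurd hab (lt_irrefl _)
      | succ b => simpa using hi _ (J.orderEmbOfFin_mem hJ b)
    | succ a =>
      induction b using Fin.cases with
      | zero => exact absurd hab (Fin.not_lt_zero _)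
      | succ b => simpa using hab

/-- Expansion of a minor along its first column. -/
theorem minor_insert_min {i : Fin n} {J : Finset (Fin n)} (hi : ∀ j ∈ J, i < j)
    (T : Finset (Fin n)) :
    minor q T (insert i J)
      = ∑ x ∈ T, (-q) ^ below T x • (gen q x i * minor q (T.erase x) J) := by
  have hiJ : i ∉ J := fun h => (hi i h).false
  have hcard : (insert i J).card = J.card + 1 := Finset.card_insert_of_notMem hiJ
  by_cases hT : T.card = J.card + 1
  swap
  · rw [minor_eq_zero (by omega), eq_comm]
    refine Finset.sum_eq_zero fun x hx => ?_
    rw [minor_eq_zero, mul_zero, smul_zero]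
    rw [Finset.card_erase_of_mem hx]
    have := Finset.card_pos.mpr ⟨x, hx⟩
    omega
  rw [minor_eq_sum_fun hT hcard, Finset.sum_filter,
    ← (Fin.consEquiv fun _ : Fin (J.card + 1) => Fin n).sum_comp, Fintype.sum_prod_type,
    ← Finset.sum_subset (Finset.subset_univ T)]
  · refine Finset.sum_congr rfl fun x hx => ?_
    have hc : (T.erase x).card = J.card := by rw [Finset.card_erase_of_mem hx]; omega
    rw [minor_eq_sum_fun hc rfl, Finset.sum_filter, Finset.mul_sum, Finset.smul_sum]
    refine Finset.sum_congr rfl fun g _ => ?_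
    have himage : Finset.univ.image (Fin.cons x g : Fin (J.card + 1) → Fin n)
        = insert x (Finset.univ.image g) := by
      ext y
      simp [Fin.exists_fin_succ, eq_comm]
    have hiff : Finset.univ.image (Fin.cons x g : Fin (J.card + 1) → Fin n) = T
        ↔ Finset.univ.image g = T.erase x := by
      rw [himage]
      constructor
      · rintro rfl
        rw [Finset.erase_insert]
        -- A repeated value would leave an image of at most `J.card` elements, too few for `T`.
        intro hmem
        rw [Finset.insert_eq_of_mem hmem] at hT
        have := Finset.card_image_le (s := Finset.univ) (f := g)
        rw [Finset.card_univ, Fintype.card_fin] at this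
        omega
      · rintro h
        rw [h, Finset.insert_erase hx]
    change (if Finset.univ.image (Fin.cons x g : Fin (J.card + 1) → Fin n) = T then _ else 0) = _
    by_cases hg : Finset.univ.image g = T.erase x
    swap
    · rw [if_neg (hiff.not.mpr hg), if_neg hg, mul_zero, smul_zero]
    rw [if_pos (hiff.mpr hg), if_pos hg]
    have hinj : Function.Injective g := by
      refine Set.injOn_univ.mp ?_
      rw [← Finset.coe_univ, ← Finset.card_image_iff, hg, Finset.card_univ, Fintype.card_fin, hc]
    have hbelow : (Finset.univ.filter fun a => g a < x).card = below T x := by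
      rw [below, ← Finset.card_image_of_injective _ hinj]
      congr 1
      ext y
      have := Finset.ext_iff.mp hg y
      simp only [Finset.mem_image, Finset.mem_univ, true_and, Finset.mem_erase] at this
      simp only [Finset.mem_image, Finset.mem_filter, Finset.mem_univ, true_and]
      constructor
      · rintro ⟨a, ha, rfl⟩
        exact ⟨(this.mp ⟨a, rfl⟩).2, ha⟩
      · rintro ⟨hy, hlt⟩
        obtain ⟨a, rfl⟩ := this.mpr ⟨hlt.ne, hy⟩
        exact ⟨a, hlt, rfl⟩
    change (-q) ^ inversions (Fin.cons x g : Fin (J.card + 1) → Fin n) • (List.ofFn fun a =>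
      gen q ((Fin.cons x g : Fin (J.card + 1) → Fin n) a)
        ((insert i J).orderEmbOfFin hcard a)).prod = _
    simp only [orderEmbOfFin_insert hi rfl hcard]
    rw [inversions_cons, hbelow, List.ofFn_succ, List.prod_cons, mul_smul_comm, smul_smul, pow_add]
    simp only [Fin.cons_zero, Fin.cons_succ]
  · intro x _ hx
    refine Finset.sum_eq_zero fun g _ => if_neg fun h => hx ?_
    rw [← h]
    exact Finset.mem_image.mpr ⟨0, Finset.mem_univ _, by simp [Fin.consEquiv]⟩


theorem below_erase (T : Finset (Fin n)) {x : Fin n} (hx : x ∈ T) (y : Fin n) :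
    below (T.erase x) y + (if x < y then 1 else 0) = below T y := by
  simp only [below, Finset.card_filter]
  exact Finset.sum_erase_add _ _ hx

theorem below_insert {T : Finset (Fin n)} {x : Fin n} (hx : x ∉ T) (y : Fin n) :
    below (insert x T) y = below T y + (if x < y then 1 else 0) := by
  rw [← below_erase (insert x T) (Finset.mem_insert_self x T) y, Finset.erase_insert hx]

/-! ### Column vectors satisfy the relations of the quantum exterior algebra. -/

/-- Left multiplication by a quantum column vector on the quantum exterior algebra with coefficients
in the quantized matrix algebra, in the basis of ordered monomials. -/
def colMul (q : k) (i : Fin n) (f : Finset (Fin n) → OqM n q) (T : Finset (Fin n)) : OqM n q :=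
  ∑ x ∈ T, (-q) ^ below T x • (gen q x i * f (T.erase x))

theorem colMul_smul (i : Fin n) (c : k) (f : Finset (Fin n) → OqM n q) :
    colMul q i (c • f) = c • colMul q i f := by
  funext T
  simp only [colMul, Pi.smul_apply, mul_smul_comm, Finset.smul_sum]
  exact Finset.sum_congr rfl fun x _ => smul_comm _ _ _

theorem colMul_zero (i : Fin n) : colMul q i 0 = 0 := by
  funext T
  simp [colMul]

/-- The two orders of removing `x < y` from `T` differ by one factor `-q`. Grouping them reduces the
relations between column vectors to identities in two rows and two columns. -/
theorem colMul_colMul (i j : Fin n) (f : Finset (Fin n) → OqM n q) (T : Finset (Fin n)) :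
    colMul q i (colMul q j f) T = ∑ x ∈ T, ∑ y ∈ T, if x < y then
      (-q) ^ (below T x + below T y - 1) •
        ((gen q x i * gen q y j + (-q) • (gen q y i * gen q x j)) * f ((T.erase x).erase y))
      else 0 := by
  have hsplit : ∀ g : Fin n → Fin n → OqM n q, ∑ x ∈ T, ∑ y ∈ T.erase x, g x y
      = ∑ x ∈ T, ∑ y ∈ T, if x < y then g x y + g y x else 0 := by
    intro g
    have h1 : ∀ x ∈ T, ∑ y ∈ T.erase x, g x y
        = ∑ y ∈ T, ((if x < y then g x y else 0) + (if y < x then g x y else 0)) := by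
      intro x hx
      rw [← Finset.filter_ne', Finset.sum_filter]
      refine Finset.sum_congr rfl fun y _ => ?_
      rcases lt_trichotomy x y with h | h | h
      · simp [h, h.ne', h.not_gt]
      · simp [h]
      · simp [h, h.ne, h.not_gt]
    rw [Finset.sum_congr rfl h1]
    simp only [Finset.sum_add_distrib]
    rw [Finset.sum_comm (s := T) (t := T) (f := fun x y => if y < x then g x y else 0),
      ← Finset.sum_add_distrib]
    refine Finset.sum_congr rfl fun x _ => ?_
    rw [← Finset.sum_add_distrib]
    exact Finset.sum_congr rfl fun y _ => by split_ifs <;> simp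
  simp only [colMul, Finset.mul_sum, Finset.smul_sum]
  rw [hsplit]
  refine Finset.sum_congr rfl fun x hx => Finset.sum_congr rfl fun y hy => ?_
  split_ifs with hxy
  swap
  · rfl
  have e1 := below_erase T hx y
  have e2 := below_erase T hy x
  rw [if_pos hxy] at e1
  rw [if_neg hxy.not_gt] at e2
  -- The subtraction is not truncated: `x` itself is counted in `below T y`.
  have e3 : below T x + below T y - 1 = below T x + below (T.erase x) y := by omega
  have e4 : below T y + below (T.erase y) x = below T x + below (T.erase x) y + 1 := by omega
  rw [e3, Finset.erase_right_comm (a := y), mul_smul_comm, mul_smul_comm, smul_smul, smul_smul,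
    ← pow_add, ← pow_add, e4, pow_succ, mul_smul, ← smul_add, add_mul, smul_mul_assoc, mul_assoc,
    mul_assoc]

theorem colMul_self (i : Fin n) (f : Finset (Fin n) → OqM n q) :
    colMul q i (colMul q i f) = 0 := by
  funext T
  rw [colMul_colMul]
  refine Finset.sum_eq_zero fun x _ => Finset.sum_eq_zero fun y _ => ?_
  split_ifs with hxy
  · rw [gen_col_of_lt hxy, ← add_smul, add_neg_cancel, zero_smul, zero_mul, smul_zero]
  · rfl

theorem colMul_comm (hq : q ≠ 0) {i j : Fin n} (hij : i < j) (f : Finset (Fin n) → OqM n q) :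
    colMul q j (colMul q i f) = (-q) • colMul q i (colMul q j f) := by
  funext T
  rw [Pi.smul_apply, colMul_colMul, colMul_colMul, Finset.smul_sum]
  refine Finset.sum_congr rfl fun x _ => ?_
  rw [Finset.smul_sum]
  refine Finset.sum_congr rfl fun y _ => ?_
  split_ifs with hxy
  swap
  · rw [smul_zero]
  have key : gen q x j * gen q y i + (-q) • (gen q y j * gen q x i)
      = (-q) • (gen q x i * gen q y j + (-q) • (gen q y i * gen q x j)) := by
    rw [gen_cross_of_lt hxy hij, qHat, gen_comm_of_lt hxy hij]
    have h : q * q⁻¹ = 1 := mul_inv_cancel₀ hq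
    generalize q⁻¹ = r at h ⊢
    generalize gen q y j * gen q x i = a
    generalize gen q y i * gen q x j = b
    match_scalars <;> first | ring1 | linear_combination -h
  rw [smul_comm (-q), key, smul_mul_assoc]

/-- Multiplication of a column vector into a minor, for an arbitrary column index. -/
theorem colMul_minor (hq : q ≠ 0) (i : Fin n) (J : Finset (Fin n)) :
    colMul q i (fun T => minor q T J)
      = if i ∈ J then 0 else (-q) ^ below J i • fun T => minor q T (insert i J) := by
  induction J using Finset.induction_on_min generalizing i with
  | empty =>
    funext T
    rw [if_neg (Finset.notMem_empty i)]
    rw [Pi.smul_apply, minor_insert_min (by simp)]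
    simp [below, colMul]
  | insert j J hj ih =>
    have hjJ : j ∉ J := fun h => (hj j h).false
    have hmin : (fun T => minor q T (insert j J)) = colMul q j fun T => minor q T J :=
      funext fun T => minor_insert_min hj T
    rcases lt_trichotomy i j with hij | rfl | hij
    · have hlt : ∀ x ∈ insert j J, i < x := by
        intro x hx
        rcases Finset.mem_insert.mp hx with rfl | hx
        · exact hij
        · exact hij.trans (hj x hx)
      rw [if_neg fun h => (hlt i h).false]
      have h0 : below (insert j J) i = 0 := by
        rw [below, Finset.card_eq_zero, Finset.filter_eq_empty_iff]
        exact fun x hx => (hlt x hx).not_gt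
      funext T
      rw [h0, pow_zero, one_smul, minor_insert_min hlt, colMul]
    · rw [if_pos (Finset.mem_insert_self _ _), hmin, colMul_self]
    · rw [hmin, colMul_comm hq hij, ih]
      by_cases hi : i ∈ J
      · rw [if_pos hi, if_pos (Finset.mem_insert_of_mem hi), colMul_zero, smul_zero]
      · rw [if_neg hi, if_neg (by simp [hi, hij.ne']), colMul_smul, smul_smul, below_insert hjJ,
          if_pos hij, pow_succ', Finset.insert_comm]
        have hlt : ∀ x ∈ insert i J, j < x := by
          intro x hx
          rcases Finset.mem_insert.mp hx with rfl | hx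
          · exact hij
          · exact hj x hx
        congr 1
        funext T
        rw [minor_insert_min hlt, colMul]

/-! ### Structure constants and the braidings that involve a vector. -/

/-- The structure constants of left multiplication by a generator of the quantum exterior algebra. -/
def mulCoeff (q : k) (T : Finset (Fin n)) (x : Fin n) (S : Finset (Fin n)) : k :=
  if x ∉ S ∧ T = insert x S then (-q) ^ below S x else 0

/-- The braiding of the vector representation with itself. -/
def braid (q : k) (u v s t : Fin n) : k :=
  (if u = s ∧ v = t then (if s = t then q⁻¹ else 1) else 0)
    + (if u = t ∧ v = s ∧ s < t then -qHat q else 0)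

/-- Number of elements of `T` strictly between `x` and `y`. -/
def between (T : Finset (Fin n)) (x y : Fin n) : ℕ := (T.filter fun z => x < z ∧ z < y).card

/-- The braiding of the vector representation with the quantum exterior algebra. -/
def vecBraid (q : k) (u : Fin n) (V : Finset (Fin n)) (t : Fin n) (T : Finset (Fin n)) : k :=
  if u = t then (if V = T then (if t ∈ T then q⁻¹ else 1) else 0)
  else if t < u ∧ t ∉ T ∧ u ∈ T ∧ V = insert t (T.erase u) then
    -qHat q * (-q) ^ between T t u else 0

theorem neg_qHat_mul (hq : q ≠ 0) : -qHat q * -q = (-q) ^ 2 - 1 := by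
  rw [qHat]; field_simp

theorem below_insert_self (S : Finset (Fin n)) (x : Fin n) : below (insert x S) x = below S x := by
  rw [below, Finset.filter_insert, if_neg (lt_irrefl x), below]

/-- Exchange of a sum over subsets with a marked element. -/
theorem sum_mulCoeff {M : Type*} [AddCommMonoid M] [Module k M] (T : Finset (Fin n))
    (f : Fin n → Finset (Fin n) → M) :
    ∑ x, ∑ S, mulCoeff q T x S • f x S = ∑ x ∈ T, (-q) ^ below T x • f x (T.erase x) := by
  rw [← Finset.sum_subset (Finset.subset_univ T)]
  · refine Finset.sum_congr rfl fun x hx => ?_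
    rw [Finset.sum_eq_single (T.erase x)]
    · rw [mulCoeff, if_pos ⟨Finset.notMem_erase x T, (Finset.insert_erase hx).symm⟩]
      have h := below_insert_self (T.erase x) x
      rw [Finset.insert_erase hx] at h
      rw [h]
    · intro S _ hS
      rw [mulCoeff, if_neg, zero_smul]
      rintro ⟨h1, rfl⟩
      exact hS (Finset.erase_insert h1).symm
    · simp
  · intro x _ hx
    refine Finset.sum_eq_zero fun S _ => ?_
    rw [mulCoeff, if_neg, zero_smul]
    rintro ⟨-, rfl⟩
    exact hx (Finset.mem_insert_self _ _)

theorem sum_mulCoeff_left {M : Type*} [AddCommMonoid M] [Module k M] (x : Fin n)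
    (S : Finset (Fin n)) (f : Finset (Fin n) → M) :
    ∑ T, mulCoeff q T x S • f T = if x ∈ S then 0 else (-q) ^ below S x • f (insert x S) := by
  split_ifs with h
  · exact Finset.sum_eq_zero fun T _ => by rw [mulCoeff, if_neg (fun h' => h'.1 h), zero_smul]
  · rw [Finset.sum_eq_single (insert x S)]
    · rw [mulCoeff, if_pos ⟨h, rfl⟩]
    · intro T _ hT
      rw [mulCoeff, if_neg (fun h' => hT h'.2), zero_smul]
    · simp

/-- Here `i` need not precede `J`. This generality is needed because braiding produces columns out
of order, which must be reassembled into minors. -/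
theorem sum_mulCoeff_minor (hq : q ≠ 0) (i : Fin n) (J T : Finset (Fin n)) :
    ∑ x, ∑ S, mulCoeff q T x S • (gen q x i * minor q S J)
      = ∑ K, mulCoeff q K i J • minor q T K := by
  rw [sum_mulCoeff, sum_mulCoeff_left]
  have h := congrFun (colMul_minor hq i J) T
  rw [colMul] at h
  rw [h]
  split_ifs <;> rfl

theorem sum_mulCoeff_min {i : Fin n} {J : Finset (Fin n)} (hi : ∀ j ∈ J, i < j)
    {M : Type*} [AddCommMonoid M] [Module k M] (f : Finset (Fin n) → M) :
    ∑ K, mulCoeff q K i J • f K = f (insert i J) := by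
  rw [sum_mulCoeff_left, if_neg fun h => (hi i h).false]
  have h0 : below J i = 0 := by
    rw [below, Finset.card_eq_zero, Finset.filter_eq_empty_iff]
    exact fun x hx => (hi x hx).not_gt
  rw [h0, pow_zero, one_smul]

theorem minor_insert_eq_sum_mulCoeff {i : Fin n} {J : Finset (Fin n)} (hi : ∀ j ∈ J, i < j)
    (T : Finset (Fin n)) :
    minor q T (insert i J) = ∑ x, ∑ S, mulCoeff q T x S • (gen q x i * minor q S J) := by
  rw [sum_mulCoeff, minor_insert_min hi]

theorem sum_braid_left (u v : Fin n) {M : Type*} [AddCommMonoid M] [Module k M]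
    (f : Fin n → Fin n → M) :
    ∑ s, ∑ t, braid q u v s t • f s t
      = (if u = v then q⁻¹ else 1 : k) • f u v + (if v < u then -qHat q else 0) • f v u := by
  simp only [braid, add_smul, Finset.sum_add_distrib, ite_and, ite_smul, zero_smul]
  simp

theorem sum_braid_right (s t : Fin n) {M : Type*} [AddCommMonoid M] [Module k M]
    (f : Fin n → Fin n → M) :
    ∑ u, ∑ v, braid q u v s t • f u v
      = (if s = t then q⁻¹ else 1 : k) • f s t + (if s < t then -qHat q else 0) • f t s := by
  simp only [braid, add_smul, Finset.sum_add_distrib, ite_and, ite_smul, zero_smul]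
  simp

/-- This is the FRT relation for the inverse R-matrix. Replacing `q` by `q⁻¹ = q - qHat q` on the
diagonal and reversing the triangular part changes both sides by the same multiple of `X_{uj}
X_{vi}`. -/
theorem braid_gen (u v i j : Fin n) :
    ∑ s, ∑ t, braid q u v s t • (gen q t j * gen q s i)
      = ∑ s, ∑ t, braid q s t i j • (gen q u s * gen q v t) := by
  rw [sum_braid_left, sum_braid_right]
  have h := gen_frt q v u j i
  have e1 : (if u = v then q⁻¹ else 1 : k)
      = (if v = u then q else 1) - (if u = v then qHat q else 0) := by
    unfold qHat; grind
  have e2 : (if i = j then q⁻¹ else 1 : k)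
      = (if j = i then q else 1) - (if i = j then qHat q else 0) := by
    unfold qHat; grind
  have k1 : (if u = v then qHat q else 0) • (gen q v j * gen q u i)
      = (if u = v then qHat q else 0) • (gen q u j * gen q v i) := by
    split_ifs with huv
    · rw [huv]
    · simp
  have k2 : (if i = j then qHat q else 0) • (gen q u i * gen q v j)
      = (if i = j then qHat q else 0) • (gen q u j * gen q v i) := by
    split_ifs with hij
    · rw [hij]
    · simp
  have e3 : (if v < u then -qHat q else 0)
      = (if u < v then qHat q else 0) + (if u = v then qHat q else 0) - qHat q := by
    rcases lt_trichotomy u v with h | h | h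
    · simp [h, h.not_gt, h.ne]
    · simp [h]
    · simp [h, h.not_gt, h.ne']
  have e4 : (if i < j then -qHat q else 0)
      = (if j < i then qHat q else 0) + (if i = j then qHat q else 0) - qHat q := by
    rcases lt_trichotomy i j with h | h | h
    · simp [h, h.not_gt, h.ne]
    · simp [h]
    · simp [h, h.not_gt, h.ne']
  rw [e1, e2, e3, e4, sub_smul, k1, sub_smul _ _ (gen q u i * gen q v j), k2]
  simp only [add_smul, sub_smul]
  generalize (if u = v then qHat q else 0) • (gen q u j * gen q v i) = a at *
  generalize (if i = j then qHat q else 0) • (gen q u j * gen q v i) = b at *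
  generalize qHat q • (gen q u j * gen q v i) = c at *
  rw [← sub_eq_zero] at h ⊢
  rw [← h]
  abel

/-! ### Compatibility of `vecBraid` with exterior multiplication. -/

theorem sum_below_geom (hq : q ≠ 0) (B : Finset (Fin n)) :
    ∑ b ∈ B, -qHat q * (-q) ^ (2 * below B b + 1) = (-q) ^ (2 * B.card) - 1 := by
  induction B using Finset.induction_on_max with
  | empty => simp
  | insert a B ha ih =>
    have haB : a ∉ B := fun h => (ha a h).false
    rw [Finset.sum_insert haB, Finset.card_insert_of_notMem haB, below_insert_self]
    have h1 : below B a = B.card := by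
      rw [below, Finset.filter_true_of_mem ha]
    have h2 : ∀ b ∈ B, below (insert a B) b = below B b := by
      intro b hb
      rw [below_insert haB, if_neg (ha b hb).not_gt, add_zero]
    rw [Finset.sum_congr rfl fun b hb => by rw [h2 b hb], ih, h1, pow_succ', ← mul_assoc,
      neg_qHat_mul hq]
    ring

theorem sum_mulCoeff_vecBraid (s t v : Fin n) (V S : Finset (Fin n)) :
    ∑ W, mulCoeff q V v W * vecBraid q s W t S
      = if s = t then mulCoeff q V v S * (if t ∈ S then q⁻¹ else 1)
        else if t < s ∧ t ∉ S ∧ s ∈ S then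
          mulCoeff q V v (insert t (S.erase s)) * (-qHat q * (-q) ^ between S t s)
        else 0 := by
  unfold vecBraid
  split_ifs with h1 h2 h3
  · simp
  · simp
  · obtain ⟨a, b, c⟩ := h3
    simp [a, b, c]
  · refine Finset.sum_eq_zero fun W _ => ?_
    rw [if_neg (fun h => h3 ⟨h.1, h.2.1, h.2.2.1⟩), mul_zero]

theorem sum_braid_mid (u x : Fin n) (f : Fin n → Fin n → k) :
    ∑ s, ∑ v, braid q u v s x * f s v
      = (if u = x then q⁻¹ else 1) * f u x
        + if u = x then ∑ s, if s < x then -qHat q * f s s else 0 else 0 := by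
  simp only [braid, add_mul, Finset.sum_add_distrib, ite_and, ite_mul, zero_mul]
  simp

theorem mulCoeff_of_mem {V S : Finset (Fin n)} {v : Fin n} (h : v ∈ S) : mulCoeff q V v S = 0 :=
  if_neg fun h' => h'.1 h

theorem below_eq_below_add_between {S : Finset (Fin n)} {t u : Fin n} (ht : t ∉ S) (htu : t < u) :
    below S u = below S t + between S t u := by
  unfold below between
  rw [← Finset.card_union_of_disjoint]
  · congr 1
    ext x
    simp only [Finset.mem_filter, Finset.mem_union]
    constructor
    · rintro ⟨hx, hxu⟩
      rcases lt_trichotomy x t with h | rfl | h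
      · exact Or.inl ⟨hx, h⟩
      · exact absurd hx ht
      · exact Or.inr ⟨hx, h, hxu⟩
    · rintro (⟨hx, h⟩ | ⟨hx, -, h⟩)
      · exact ⟨hx, h.trans htu⟩
      · exact ⟨hx, h⟩
  · rw [Finset.disjoint_left]
    intro x hx hx'
    exact (Finset.mem_filter.mp hx).2.not_gt (Finset.mem_filter.mp hx').2.1

theorem between_insert {S : Finset (Fin n)} {x : Fin n} (hx : x ∉ S) (t u : Fin n) :
    between (insert x S) t u = between S t u + if t < x ∧ x < u then 1 else 0 := by
  unfold between
  rw [Finset.filter_insert]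
  split_ifs
  · exact Finset.card_insert_of_notMem fun h => hx (Finset.mem_of_mem_filter _ h)
  · rfl

theorem below_insert_erase {S : Finset (Fin n)} {t u : Fin n} (ht : t ∉ S) (hu : u ∈ S)
    (hS : t < u) : below (insert t (S.erase u)) u = below S t + between S t u + 1 := by
  have h := below_erase S hu u
  rw [if_neg (lt_irrefl u), add_zero] at h
  rw [below_insert (fun h => ht (Finset.mem_of_mem_erase h)), if_pos hS, h,
    below_eq_below_add_between ht hS]

theorem mulCoeff_insert_erase {S V : Finset (Fin n)} {t u : Fin n} (ht : t ∉ S) (hu : u ∈ S)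
    (hS : t < u) : mulCoeff q V u (insert t (S.erase u))
      = if V = insert t S then (-q) ^ (below S t + between S t u + 1) else 0 := by
  rw [mulCoeff, Finset.insert_comm, Finset.insert_erase hu, below_insert_erase ht hu hS]
  have : u ∉ insert t (S.erase u) := by simp [hS.ne']
  simp only [this, not_false_eq_true, true_and]

theorem sum_between_geom (hq : q ≠ 0) (S : Finset (Fin n)) (t u : Fin n) :
    ∑ s, (if t < s ∧ s < u ∧ s ∈ S then -qHat q * (-q) ^ (2 * between S t s + 1) else 0)
      = (-q) ^ (2 * between S t u) - 1 := by
  rw [between, ← sum_below_geom hq, ← Finset.sum_filter]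
  refine Finset.sum_congr ?_ fun s hs => ?_
  · ext s
    simp only [Finset.mem_filter, Finset.mem_univ, true_and]
    tauto
  · have : below (S.filter fun z => t < z ∧ z < u) s = between S t s := by
      rw [below, between, Finset.filter_filter]
      congr 1
      refine Finset.filter_congr fun z _ => ?_
      have : s < u := (Finset.mem_filter.mp hs).2.2
      exact ⟨fun h => ⟨h.1.1, h.2⟩, fun h => ⟨⟨h.1, h.2.trans this⟩, h.2⟩⟩
    rw [this]

theorem vecBraid_insert_self {S V : Finset (Fin n)} {t u : Fin n} (hu : u ∉ S) (htu : t < u) :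
    vecBraid q u V t (insert u S)
      = if t ∉ S ∧ V = insert t S then -qHat q * (-q) ^ between S t u else 0 := by
  have h1 : between (insert u S) t u = between S t u := by rw [between_insert hu]; simp
  have h2 : t ∉ insert u S ↔ t ∉ S := by simp [htu.ne]
  rw [vecBraid, if_neg htu.ne', Finset.erase_insert hu, h1]
  simp only [h2, htu, Finset.mem_insert_self, true_and]

theorem vecBraid_insert_of_ne {S V : Finset (Fin n)} {t u x : Fin n} (hx : x ∉ S) (htu : t < u)
    (hxu : u ≠ x) : (-q) ^ below S x * vecBraid q u V t (insert x S)
      = if t ∉ S ∧ u ∈ S then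
          mulCoeff q V x (insert t (S.erase u)) * (-qHat q * (-q) ^ between S t u) else 0 := by
  rw [vecBraid, if_neg htu.ne']
  by_cases hxt : x = t
  · subst hxt
    rw [if_neg (by simp), mul_zero, mulCoeff_of_mem (Finset.mem_insert_self _ _), zero_mul, ite_self]
  have h1 : t ∉ insert x S ↔ t ∉ S := by simp [Ne.symm hxt]
  have h2 : u ∈ insert x S ↔ u ∈ S := by simp [hxu]
  simp only [h1, h2, htu, true_and]
  by_cases ht : t ∈ S
  · simp [ht]
  by_cases hu : u ∈ S
  swap
  · simp [hu]
  have h3 : insert t ((insert x S).erase u) = insert x (insert t (S.erase u)) := by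
    rw [Finset.erase_insert_of_ne hxu.symm, Finset.insert_comm]
  have h4 : x ∉ insert t (S.erase u) := by simp [hxt, hx]
  -- When `t < x < u`, the element `x` lengthens the gap between `t` and `u`, while replacing `u` by
  -- `t` puts one more element below `x`.
  have h5 : below S x + between (insert x S) t u
      = below (insert t (S.erase u)) x + between S t u := by
    have e := below_erase S hu x
    rw [between_insert hx, below_insert (fun h => ht (Finset.mem_of_mem_erase h)), ← e]
    by_cases c1 : t < x <;> by_cases c2 : x < u
    · simp [c1, c2, c2.not_gt]; ring
    · have c3 : u < x := lt_of_le_of_ne (not_lt.mp c2) hxu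
      simp [c1, c2, c3]
    · simp [c1, c2.not_gt]
    · exact absurd (htu.trans_le (not_lt.mp c2)) c1
  simp only [ht, hu, not_false_eq_true, true_and, and_self, if_true, h3, mulCoeff, h4]
  split_ifs
  · rw [mul_left_comm, ← pow_add, h5, pow_add]
    ring
  · ring

/-- Braiding a vector past `e_x e_S` amounts to braiding it past `e_S` and then past `e_x`. The case
with content is `u = x`, `t < u`, `t ∉ S`, where the intermediate index `s` runs through a geometric
sum. -/
theorem vecBraid_mulCoeff (hq : q ≠ 0) (u t x : Fin n) (V S : Finset (Fin n)) :
    ∑ T, mulCoeff q T x S * vecBraid q u V t T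
      = ∑ s, ∑ v, braid q u v s x * ∑ W, mulCoeff q V v W * vecBraid q s W t S := by
  have hL := sum_mulCoeff_left (q := q) x S fun T => vecBraid q u V t T
  simp only [smul_eq_mul] at hL
  rw [hL, sum_braid_mid]
  simp only [sum_mulCoeff_vecBraid]
  rcases le_or_gt u t with hut | hut
  · have hz : (if u = x then ∑ s, (if s < x then -qHat q * if s = t then
          mulCoeff q V s S * (if t ∈ S then q⁻¹ else 1)
        else if t < s ∧ t ∉ S ∧ s ∈ S then
          mulCoeff q V s (insert t (S.erase s)) * (-qHat q * (-q) ^ between S t s) else 0 else 0)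
        else 0) = 0 := by
      refine ite_eq_right_iff.mpr fun hux => Finset.sum_eq_zero fun s _ => ?_
      subst hux
      refine ite_eq_right_iff.mpr fun hs => ?_
      rw [if_neg (hs.trans_le hut).ne, if_neg fun h : t < s ∧ _ => (hs.trans_le hut).not_gt h.1,
        mul_zero]
    rw [hz, add_zero]
    rcases hut.lt_or_eq with hut | rfl
    · have h1 : ∀ T, vecBraid q u V t T = 0 := fun T => by
        rw [vecBraid, if_neg hut.ne, if_neg fun h => hut.not_gt h.1]
      rw [if_neg hut.ne, if_neg (fun h : t < u ∧ _ => hut.not_gt h.1), mul_zero, h1, mul_zero,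
        ite_self]
    · rw [vecBraid, if_pos rfl, if_pos rfl, mulCoeff]
      by_cases hx : x ∈ S
      · simp [hx]
      · by_cases hux : u = x
        · subst hux
          by_cases hV : V = insert u S <;> simp [hx, hV, mul_comm]
        · by_cases hV : V = insert x S <;> simp [hx, hV, hux]
  · by_cases hux : u = x
    swap
    · rw [if_neg hux, if_neg hux, one_mul, add_zero, if_neg hut.ne']
      simp only [hut, true_and]
      by_cases hx : x ∈ S
      · rw [if_pos hx, mulCoeff_of_mem, zero_mul, ite_self]
        simp [hx, Ne.symm hux]
      · rw [if_neg hx, vecBraid_insert_of_ne hx hut hux]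
    subst hux
    rw [if_pos rfl, if_pos rfl, if_neg hut.ne']
    by_cases ht : t ∈ S
    · have h1 : vecBraid q u V t (insert u S) = 0 := by
        rw [vecBraid, if_neg hut.ne', if_neg fun h => h.2.1 (Finset.mem_insert_of_mem ht)]
      rw [h1, mul_zero, ite_self, if_neg fun h => h.2.1 ht, mul_zero, zero_add]
      symm
      refine Finset.sum_eq_zero fun s _ => ?_
      rw [if_neg fun h : t < s ∧ _ => h.2.1 ht]
      split_ifs with h2 h3
      · rw [h3, mulCoeff_of_mem ht, zero_mul, mul_zero]
      · rw [mul_zero]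
      · rfl
    -- The term `s = t` supplies the `1` that completes the geometric sum over `t < s < u` to a
    -- single power.
    have hsum : ∑ s, (if s < u then -qHat q * if s = t then
          mulCoeff q V s S * (if t ∈ S then q⁻¹ else 1)
        else if t < s ∧ t ∉ S ∧ s ∈ S then
          mulCoeff q V s (insert t (S.erase s)) * (-qHat q * (-q) ^ between S t s) else 0 else 0)
        = if V = insert t S then
            -qHat q * (-q) ^ (below S t + 2 * between S t u) else 0 := by
      have hterm : ∀ s, (if s < u then -qHat q * if s = t then
          mulCoeff q V s S * (if t ∈ S then q⁻¹ else 1)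
        else if t < s ∧ t ∉ S ∧ s ∈ S then
          mulCoeff q V s (insert t (S.erase s)) * (-qHat q * (-q) ^ between S t s) else 0 else 0)
        = if V = insert t S then -qHat q * (-q) ^ below S t * ((if s = t then 1 else 0)
          + if t < s ∧ s < u ∧ s ∈ S then -qHat q * (-q) ^ (2 * between S t s + 1) else 0)
          else 0 := by
        intro s
        rcases lt_trichotomy s t with h | h | h
        · simp [h.ne, h.not_gt]
        · subst h
          simp [hut, ht, mulCoeff]
        · by_cases hsS : s ∈ S
          · rw [mulCoeff_insert_erase ht hsS h]
            simp only [h, h.ne', hsS, ht, not_false_eq_true, true_and, and_true, and_self, if_true,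
              if_false]
            split_ifs
            · ring
            · ring
            · ring
            · rfl
          · simp [hsS, h.ne']
      simp only [hterm]
      split_ifs
      · rw [← Finset.mul_sum, Finset.sum_add_distrib, sum_between_geom hq, Finset.sum_ite_eq',
          if_pos (Finset.mem_univ _)]
        ring
      · simp
    rw [hsum]
    by_cases hu : u ∈ S
    · rw [if_pos hu, if_pos ⟨hut, ht, hu⟩, mulCoeff_insert_erase ht hu hut]
      split_ifs
      · have : q⁻¹ * q = 1 := inv_mul_cancel₀ hq
        linear_combination (-qHat q) * (-q) ^ (below S t + 2 * between S t u) * this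
      · ring
    · rw [if_neg hu, if_neg fun h => hu h.2.2, vecBraid_insert_self hu hut,
        below_eq_below_add_between ht hut]
      simp only [ht, not_false_eq_true, true_and]
      split_ifs
      · ring
      · ring

/-! ### Commuting a minor with a generator. -/

theorem minor_empty_right (T : Finset (Fin n)) : minor q T ∅ = if T = ∅ then 1 else 0 := by
  split_ifs with h
  · subst h
    rw [minor_eq_sum_fun (t := 0) rfl rfl]
    simp [inversions]
  · refine minor_eq_zero fun h' => h ?_
    rw [Finset.card_empty] at h'
    exact Finset.card_eq_zero.mp h'.symm

/-- Commutation of a minor with a generator. -/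
theorem vecBraid_minor_gen (hq : q ≠ 0) (N : Finset (Fin n)) (u i : Fin n) (V : Finset (Fin n)) :
    ∑ t, ∑ T, vecBraid q u V t T • (minor q T N * gen q t i)
      = ∑ s, ∑ S, vecBraid q s S i N • (gen q u s * minor q V S) := by
  induction N using Finset.induction_on_min generalizing u i V with
  | empty =>
    simp [vecBraid, minor_empty_right, ite_and]
  | insert j N hj ih =>
    simp only [minor_insert_eq_sum_mulCoeff hj]
    -- The generator in column `i` passes the minor on `N` by induction and the generator in column
    -- `j` by `braid_gen`. The columns are then reassembled by `sum_mulCoeff_minor`, and the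
    -- coefficients by `vecBraid_mulCoeff` read backwards.
    calc
      _ = ∑ t, ∑ x, ∑ S, (∑ T, mulCoeff q T x S * vecBraid q u V t T) •
            (gen q x j * (minor q S N * gen q t i)) := by
        refine Finset.sum_congr rfl fun t _ => ?_
        simp only [Finset.sum_mul, Finset.smul_sum, Finset.sum_smul, ← Fintype.sum_prod_type']
        refine Fintype.sum_equiv ⟨fun p => ⟨p.2.1, p.2.2, p.1⟩, fun p => ⟨p.2.2, p.1, p.2.1⟩,
          fun _ => rfl, fun _ => rfl⟩ _ _ fun p => ?_
        simp only [Equiv.coe_fn_mk, smul_mul_assoc, smul_smul, mul_assoc, mul_comm]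
      _ = ∑ v, ∑ W, mulCoeff q V v W • ∑ s, ∑ x, braid q u v s x •
            (gen q x j * ∑ t, ∑ S, vecBraid q s W t S • (minor q S N * gen q t i)) := by
        simp only [vecBraid_mulCoeff hq]
        simp only [Finset.mul_sum, Finset.smul_sum, Finset.sum_smul, ← Fintype.sum_prod_type']
        refine Fintype.sum_equiv ⟨fun ⟨t, x, S, s, v, W⟩ => ⟨v, W, s, x, t, S⟩,
          fun ⟨v, W, s, x, t, S⟩ => ⟨t, x, S, s, v, W⟩,
          fun _ => rfl, fun _ => rfl⟩ _ _ fun ⟨t, x, S, s, v, W⟩ => ?_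
        simp only [Equiv.coe_fn_mk, mul_smul_comm, smul_smul]
        congr 1
        ring
      _ = ∑ a, ∑ B, ∑ v, ∑ W, (vecBraid q a B i N * mulCoeff q V v W) •
            ((∑ s, ∑ x, braid q u v s x • (gen q x j * gen q s a)) * minor q W B) := by
        simp only [ih]
        simp only [Finset.mul_sum, Finset.sum_mul, Finset.smul_sum, ← Fintype.sum_prod_type']
        refine Fintype.sum_equiv ⟨fun ⟨v, W, s, x, a, B⟩ => ⟨a, B, v, W, s, x⟩,
          fun ⟨a, B, v, W, s, x⟩ => ⟨v, W, s, x, a, B⟩,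
          fun _ => rfl, fun _ => rfl⟩ _ _ fun ⟨v, W, s, x, a, B⟩ => ?_
        simp only [Equiv.coe_fn_mk, mul_smul_comm, smul_mul_assoc, smul_smul, mul_assoc]
        congr 1
        ring
      _ = ∑ a, ∑ B, ∑ c, ∑ d, (vecBraid q a B i N * braid q c d a j) •
            (gen q u c * ∑ v, ∑ W, mulCoeff q V v W • (gen q v d * minor q W B)) := by
        simp only [braid_gen]
        refine Finset.sum_congr rfl fun a _ => Finset.sum_congr rfl fun B _ => ?_
        simp only [Finset.mul_sum, Finset.sum_mul, Finset.smul_sum, ← Fintype.sum_prod_type']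
        refine Fintype.sum_equiv ⟨fun ⟨v, W, c, d⟩ => ⟨c, d, v, W⟩,
          fun ⟨c, d, v, W⟩ => ⟨v, W, c, d⟩,
          fun _ => rfl, fun _ => rfl⟩ _ _ fun ⟨v, W, c, d⟩ => ?_
        simp only [Equiv.coe_fn_mk, mul_smul_comm, smul_mul_assoc, smul_smul, mul_assoc]
        congr 1
        ring
      _ = ∑ c, ∑ K, (∑ a, ∑ d, braid q c d a j * ∑ B, mulCoeff q K d B * vecBraid q a B i N) •
            (gen q u c * minor q V K) := by
        simp only [sum_mulCoeff_minor hq]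
        simp only [Finset.mul_sum, Finset.smul_sum, Finset.sum_smul, ← Fintype.sum_prod_type']
        refine Fintype.sum_equiv ⟨fun ⟨a, B, c, d, K⟩ => ⟨c, K, a, d, B⟩,
          fun ⟨c, K, a, d, B⟩ => ⟨a, B, c, d, K⟩,
          fun _ => rfl, fun _ => rfl⟩ _ _ fun ⟨a, B, c, d, K⟩ => ?_
        simp only [Equiv.coe_fn_mk, mul_smul_comm, smul_smul]
        congr 1
        ring
      _ = _ := by
        simp only [← vecBraid_mulCoeff hq]
        refine Finset.sum_congr rfl fun c _ => Finset.sum_congr rfl fun K _ => ?_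
        have h := sum_mulCoeff_min (q := q) hj fun T => vecBraid q c K i T
        simp only [smul_eq_mul] at h
        rw [h]

/-! ### Lattice paths and the coefficients of the braiding of two minors. -/

/-- The indicator function of a subset of `Fin n`, on the natural numbers. -/
def bit (T : Finset (Fin n)) (x : ℕ) : ℤ := if ∃ y ∈ T, (y : ℕ) = x then 1 else 0

theorem bit_coe (T : Finset (Fin n)) (x : Fin n) : bit T x = if x ∈ T then 1 else 0 := by
  unfold bit
  congr 1
  simp [Fin.val_inj]

theorem bit_eq_zero_or_one (T : Finset (Fin n)) (x : ℕ) : bit T x = 0 ∨ bit T x = 1 := by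
  unfold bit
  split_ifs <;> simp

theorem bit_insert {T : Finset (Fin n)} {t : Fin n} (ht : t ∉ T) (x : ℕ) :
    bit (insert t T) x = bit T x + if x = t then 1 else 0 := by
  unfold bit
  by_cases h : x = t
  · subst h
    have : ¬ ∃ y ∈ T, (y : ℕ) = t := by rintro ⟨y, hy, h⟩; exact ht (Fin.ext h ▸ hy)
    simp [this]
  · simp [h, Ne.symm h]

theorem bit_erase {T : Finset (Fin n)} {t : Fin n} (ht : t ∈ T) (x : ℕ) :
    bit (T.erase t) x = bit T x - if x = t then 1 else 0 := by
  have h := bit_insert (Finset.notMem_erase t T) x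
  rw [Finset.insert_erase ht] at h
  omega

theorem sum_bit (T : Finset (Fin n)) (s : Finset ℕ) :
    ∑ x ∈ s, bit T x = (T.filter fun y : Fin n => (y : ℕ) ∈ s).card := by
  unfold bit
  rw [Finset.sum_boole, ← Finset.card_map Fin.valEmbedding]
  congr 2
  ext x
  simp only [Finset.mem_filter, Finset.mem_map, Fin.valEmbedding_apply]
  constructor
  · rintro ⟨hx, y, hy, rfl⟩
    exact ⟨y, ⟨hy, hx⟩, rfl⟩
  · rintro ⟨y, ⟨hy, hx⟩, rfl⟩
    exact ⟨hx, y, hy, rfl⟩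

theorem sum_range_bit (T : Finset (Fin n)) : ∑ x ∈ Finset.range n, bit T x = T.card := by
  rw [sum_bit, Finset.filter_true_of_mem fun (y : Fin n) _ => Finset.mem_range.mpr y.2]

theorem prod_zpow {ι : Type*} (s : Finset ι) (f : ι → ℤ) {p : k} (hp : p ≠ 0) :
    ∏ x ∈ s, p ^ f x = p ^ ∑ x ∈ s, f x := by
  classical
  induction s using Finset.induction_on with
  | empty => simp
  | insert a s ha ih => rw [Finset.prod_insert ha, Finset.sum_insert ha, zpow_add₀ hp, ih]

theorem pow_below (hq : q ≠ 0) (T : Finset (Fin n)) (x : Fin n) :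
    (-q) ^ below T x = ∏ y ∈ Finset.range x, (-q) ^ bit T y := by
  rw [prod_zpow _ _ (neg_ne_zero.mpr hq), sum_bit, zpow_natCast]
  simp [below]

theorem pow_between (hq : q ≠ 0) (T : Finset (Fin n)) (t u : Fin n) :
    (-q) ^ between T t u = ∏ y ∈ Finset.Ico ((t : ℕ) + 1) u, (-q) ^ bit T y := by
  rw [prod_zpow _ _ (neg_ne_zero.mpr hq), sum_bit, zpow_natCast]
  simp [between]

/-- Height of the lattice path with up-steps `y` and down-steps `a`. -/
def height (y a : ℕ → ℤ) (x : ℕ) : ℤ := ∑ z ∈ Finset.range x, (y z - a z)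

theorem height_succ (y a : ℕ → ℤ) (x : ℕ) : height y a (x + 1) = height y a x + (y x - a x) :=
  Finset.sum_range_succ _ _

/-- The weight of a single site at height `h`, where `y` and `z` are the occupation numbers of
the two incoming sets, and `a` the one of the first outgoing set. -/
def siteWeight (q : k) (y z a h : ℤ) : k :=
  if y = z then (if y = 0 then 1 else q⁻¹)
  else if y = 0 ∧ a = 1 then (-q) ^ h - (-q) ^ (-h) else (-q) ^ h

/-- The weight of the first `m` sites of a configuration. -/
def pathWeight (q : k) (y z a : ℕ → ℤ) (m : ℕ) : k :=
  ∏ x ∈ Finset.range m, siteWeight q (y x) (z x) (a x) (height y a x)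

/-- A path of nonzero weight stays above the axis. -/
theorem height_nonneg {y z a : ℕ → ℤ} {m : ℕ} (hy : ∀ x, y x = 0 ∨ y x = 1)
    (ha : ∀ x, a x = 0 ∨ a x = 1) (hz : ∀ x < m, y x = 0 → a x = 1 → z x ≠ 0)
    (h : pathWeight q y z a m ≠ 0) : 0 ≤ height y a m := by
  induction m with
  | zero => simp [height]
  | succ m ih =>
    rw [pathWeight, Finset.prod_range_succ] at h
    have h1 := ih (fun x hx => hz x (hx.trans m.lt_succ_self)) (left_ne_zero_of_mul h)
    rw [height_succ]
    rcases hy m with hym | hym <;> rcases ha m with ham | ham <;> rw [hym, ham] <;> try omega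
    have h2 := right_ne_zero_of_mul h
    -- The only remaining danger is a down-step from the axis, and its weight `(-q)^0 - (-q)^0` is
    -- zero.
    have h3 : height y a m ≠ 0 := by
      intro h0
      apply h2
      rw [siteWeight, if_neg, if_pos ⟨hym, ham⟩, h0]
      · simp
      · rw [hym]; exact (hz m m.lt_succ_self hym ham).symm
    omega

/-- Coefficients of the braiding of two homogeneous components of the quantum exterior algebra. -/
def minorBraid (q : k) (S S' J N : Finset (Fin n)) : k :=
  if (∀ x : Fin n, bit J x + bit N x = bit S x + bit S' x) ∧ S.card = J.card then
    pathWeight q (bit J) (bit N) (bit S) n else 0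

/-- Each summand is the difference of two consecutive hybrid products, with `A` to the left of the
cut, `B` to the right and `α` at the cut. -/
theorem sum_telescope (A B K α : ℕ → k) (l m : ℕ) (hlm : l ≤ m)
    (h : ∀ x, l ≤ x → x < m → K x = α x * B x - α (x + 1) * A x) :
    ∑ u ∈ Finset.Ico l m,
        (∏ x ∈ Finset.Ico l u, A x) * K u * ∏ x ∈ Finset.Ico (u + 1) m, B x
      = α l * ∏ x ∈ Finset.Ico l m, B x - α m * ∏ x ∈ Finset.Ico l m, A x := by
  induction m, hlm using Nat.le_induction with
  | base => simp
  | succ m hlm ih =>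
    have ih := ih fun x h1 h2 => h x h1 (h2.trans m.lt_succ_self)
    rw [Finset.sum_Ico_succ_top hlm, Finset.prod_Ico_succ_top hlm, Finset.prod_Ico_succ_top hlm,
      Finset.Ico_self, Finset.prod_empty, h m hlm m.lt_succ_self]
    have : ∀ u ∈ Finset.Ico l m,
        (∏ x ∈ Finset.Ico l u, A x) * K u * ∏ x ∈ Finset.Ico (u + 1) (m + 1), B x
        = ((∏ x ∈ Finset.Ico l u, A x) * K u * ∏ x ∈ Finset.Ico (u + 1) m, B x) * B m := by
      intro u hu
      rw [Finset.prod_Ico_succ_top (Finset.mem_Ico.mp hu).2, mul_assoc, mul_assoc, mul_assoc]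
    rw [Finset.sum_congr rfl this, ← Finset.sum_mul, ih]
    ring

theorem siteWeight_empty (a h : ℤ) : siteWeight q 0 0 a h = 1 := by simp [siteWeight]

theorem siteWeight_full (a h : ℤ) : siteWeight q 1 1 a h = q⁻¹ := by simp [siteWeight]

theorem siteWeight_left (a h : ℤ) : siteWeight q 1 0 a h = (-q) ^ h := by simp [siteWeight]

theorem siteWeight_right (h : ℤ) : siteWeight q 0 1 0 h = (-q) ^ h := by simp [siteWeight]

theorem siteWeight_down (h : ℤ) : siteWeight q 0 1 1 h = (-q) ^ h - (-q) ^ (-h) := by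
  simp [siteWeight]

/-- The local exchange relation behind the telescoping sum. -/
theorem siteWeight_exchange (hq : q ≠ 0) {y z a b : ℤ} (h : ℤ) (hy : y = 0 ∨ y = 1)
    (hz : z = 0 ∨ z = 1) (ha : a = 0 ∨ a = 1) (hb : b = 0 ∨ b = 1) (hyz : y + z = a + b) :
    (if a = 1 ∧ z = 1 then -qHat q * siteWeight q y 0 0 (h - 1) else 0)
      = (-q) ^ (h - 1) * siteWeight q y z a h
        - (-q) ^ (h + (y - a) - 1) * ((-q) ^ a * (-q) ^ z * siteWeight q y z a (h - 1)) := by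
  obtain ⟨p, rfl⟩ : ∃ p, q = -p := ⟨-q, (neg_neg q).symm⟩
  have hp : p ≠ 0 := neg_ne_zero.mp hq
  have hP : p ^ h ≠ 0 := zpow_ne_zero _ hp
  rcases hy with rfl | rfl <;> rcases hz with rfl | rfl <;> rcases ha with rfl | rfl <;>
    rcases hb with rfl | rfl <;> first
    | (exfalso; omega)
    | simp only [siteWeight_empty, siteWeight_full, siteWeight_left, siteWeight_right,
        siteWeight_down, neg_neg, zero_ne_one, and_self, and_true, and_false,
        if_true, if_false, zpow_zero, zpow_one, zpow_add₀ hp, zpow_sub₀ hp, zpow_neg, qHat] <;>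
      field_simp <;> ring

/-- The local relation at the site of the new element. -/
theorem siteWeight_start (hq : q ≠ 0) {y z a b : ℤ} (h : ℤ) (hy : y = 0 ∨ y = 1)
    (hz : z = 0 ∨ z = 1) (ha : a = 0 ∨ a = 1) (hb : b = 0 ∨ b = 1) (hyz : y + 1 + z = a + b) :
    (if y = 0 then (-q) ^ h * siteWeight q 1 z a h else 0)
      = (if a = 1 then (if z = 1 then q⁻¹ else 1) * siteWeight q y z 0 h else 0)
        + (if z = 0 then siteWeight q y 1 a h * (-q) ^ a * (-q) ^ (h + (y + 1 - a) - 1) else 0) := by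
  obtain ⟨p, rfl⟩ : ∃ p, q = -p := ⟨-q, (neg_neg q).symm⟩
  have hp : p ≠ 0 := neg_ne_zero.mp hq
  have hP : p ^ h ≠ 0 := zpow_ne_zero _ hp
  rcases hy with rfl | rfl <;> rcases hz with rfl | rfl <;> rcases ha with rfl | rfl <;>
    rcases hb with rfl | rfl <;> first
    | (exfalso; omega)
    | simp only [siteWeight_empty, siteWeight_full, siteWeight_left, siteWeight_right,
        siteWeight_down, neg_neg, zero_ne_one, one_ne_zero,
        if_true, if_false, zpow_zero, zpow_one, zpow_add₀ hp, zpow_sub₀ hp, zpow_neg] <;>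
      field_simp <;> ring

theorem height_add_left (y a : ℕ → ℤ) (t x : ℕ) :
    height (fun x => y x + if x = t then 1 else 0) a x
      = height y a x + if t < x then 1 else 0 := by
  simp only [height, Finset.sum_sub_distrib, Finset.sum_add_distrib, Finset.sum_ite_eq',
    Finset.mem_range]
  ring

theorem height_sub_right (y a : ℕ → ℤ) (t x : ℕ) :
    height y (fun x => a x - if x = t then 1 else 0) x
      = height y a x + if t < x then 1 else 0 := by
  simp only [height, Finset.sum_sub_distrib, Finset.sum_ite_eq', Finset.mem_range]
  ring

theorem prod_range_split {t m : ℕ} (htm : t < m) (f : ℕ → k) :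
    ∏ x ∈ Finset.range m, f x
      = (∏ x ∈ Finset.range t, f x) * f t * ∏ x ∈ Finset.Ico (t + 1) m, f x := by
  rw [← Finset.prod_range_succ, Finset.prod_range_mul_prod_Ico _ htm]

theorem prod_range_split₂ {t u m : ℕ} (htu : t < u) (hum : u < m) (f : ℕ → k) :
    ∏ x ∈ Finset.range m, f x
      = (∏ x ∈ Finset.range t, f x) * f t * (∏ x ∈ Finset.Ico (t + 1) u, f x) * f u
        * ∏ x ∈ Finset.Ico (u + 1) m, f x := by
  rw [prod_range_split hum, prod_range_split htu]

/-- The scalar identity behind `minorBraid_mulCoeff`. All paths involved agree up to `t`. The sum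
over the removed element `u` telescopes: its lower end combines with the term `u = t` at site `t`
(`siteWeight_start`), and its upper end vanishes. -/
theorem pathWeight_exchange (hq : q ≠ 0) {y z a b : ℕ → ℤ} {t m : ℕ} (htm : t < m)
    (hy : ∀ x, y x = 0 ∨ y x = 1) (hz : ∀ x, z x = 0 ∨ z x = 1)
    (ha : ∀ x, a x = 0 ∨ a x = 1) (hb : ∀ x, b x = 0 ∨ b x = 1)
    (hc : ∀ x < m, y x + (if x = t then 1 else 0) + z x = a x + b x)
    (hm : height y a m = -1) :
    (if y t = 0 then (∏ x ∈ Finset.range t, (-q) ^ y x)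
        * pathWeight q (fun x => y x + if x = t then 1 else 0) z a m else 0)
      = (if a t = 1 then (∏ x ∈ Finset.range t, (-q) ^ a x) * ((if z t = 1 then q⁻¹ else 1)
          * pathWeight q y z (fun x => a x - if x = t then 1 else 0) m) else 0)
        + ∑ u ∈ Finset.Ico (t + 1) m, if z t = 0 ∧ a u = 1 ∧ z u = 1 then
          (∏ x ∈ Finset.range u, (-q) ^ a x) *
            ((-qHat q * ∏ x ∈ Finset.Ico (t + 1) u, (-q) ^ z x)
              * pathWeight q y (fun x => (z x + if x = t then 1 else 0) - if x = u then 1 else 0)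
                (fun x => a x - if x = u then 1 else 0) m) else 0 := by
  have hp : -q ≠ 0 := neg_ne_zero.mpr hq
  -- `H` is the height of the path on the left-hand side. The path of the term `u` runs at `H - 1`
  -- strictly after `t` up to `u`, and at `H` after `u`; hence the factors `A` before `u` and `B`
  -- after it.
  set H : ℕ → ℤ := fun x => height y a x + if t < x then 1 else 0 with hH
  set G := ∏ x ∈ Finset.range t, siteWeight q (y x) (z x) (a x) (H x) with hG
  set B : ℕ → k := fun x => siteWeight q (y x) (z x) (a x) (H x) with hB
  set A : ℕ → k := fun x => (-q) ^ a x * (-q) ^ z x * siteWeight q (y x) (z x) (a x) (H x - 1)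
    with hA
  set Q := ∏ x ∈ Finset.range t, (-q) ^ a x with hQ
  have hlt : ∀ x ∈ Finset.range t, x ≠ t := fun x hx => (Finset.mem_range.mp hx).ne
  have hgt : ∀ x ∈ Finset.Ico (t + 1) m, x ≠ t ∧ t < x := fun x hx =>
    ⟨(Nat.lt_of_succ_le (Finset.mem_Ico.mp hx).1).ne', Nat.lt_of_succ_le (Finset.mem_Ico.mp hx).1⟩
  have hHt : H t = height y a t := by simp [hH]
  have e1 : pathWeight q (fun x => y x + if x = t then 1 else 0) z a m
      = G * siteWeight q (y t + 1) (z t) (a t) (H t) * ∏ x ∈ Finset.Ico (t + 1) m, B x := by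
    simp only [pathWeight, height_add_left]
    rw [prod_range_split htm]
    congr 1
    · congr 1
      · exact Finset.prod_congr rfl fun x hx => by rw [if_neg (hlt x hx), add_zero]
      · rw [if_pos rfl]
    · exact Finset.prod_congr rfl fun x hx => by rw [if_neg (hgt x hx).1, add_zero]
  have e2 : pathWeight q y z (fun x => a x - if x = t then 1 else 0) m
      = G * siteWeight q (y t) (z t) (a t - 1) (H t) * ∏ x ∈ Finset.Ico (t + 1) m, B x := by
    simp only [pathWeight, height_sub_right]
    rw [prod_range_split htm]
    congr 1
    · congr 1
      · exact Finset.prod_congr rfl fun x hx => by rw [if_neg (hlt x hx), sub_zero]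
      · rw [if_pos rfl]
    · exact Finset.prod_congr rfl fun x hx => by rw [if_neg (hgt x hx).1, sub_zero]
  have e3 : ∀ u ∈ Finset.Ico (t + 1) m,
      pathWeight q y (fun x => (z x + if x = t then 1 else 0) - if x = u then 1 else 0)
        (fun x => a x - if x = u then 1 else 0) m
      = G * siteWeight q (y t) (z t + 1) (a t) (H t)
        * (∏ x ∈ Finset.Ico (t + 1) u, siteWeight q (y x) (z x) (a x) (H x - 1))
        * siteWeight q (y u) (z u - 1) (a u - 1) (H u - 1)
        * ∏ x ∈ Finset.Ico (u + 1) m, B x := by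
    intro u hu
    obtain ⟨hut, htu⟩ := hgt u hu
    simp only [pathWeight, height_sub_right]
    rw [prod_range_split₂ htu (Finset.mem_Ico.mp hu).2]
    congr 1
    · congr 1
      · congr 1
        · congr 1
          · refine Finset.prod_congr rfl fun x hx => ?_
            have hx' := Finset.mem_range.mp hx
            simp [hH, hx'.ne, (hx'.trans htu).ne, hx'.not_gt, (hx'.trans htu).not_gt]
          · simp [hH, htu.ne, htu.not_gt]
        · refine Finset.prod_congr rfl fun x hx => ?_
          obtain ⟨h1, h2⟩ := Finset.mem_Ico.mp hx
          have h1 : t < x := h1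
          simp [hH, h1.ne', h1, h2.ne, h2.not_gt]
      · simp [hH, hut, htu]
    · refine Finset.prod_congr rfl fun x hx => ?_
      have h1 : u < x := (Finset.mem_Ico.mp hx).1
      simp [hB, hH, h1.ne', h1, (htu.trans h1).ne', htu.trans h1]
  -- The upper end of the telescoping sum is, up to powers of `-q`, the weight of a path ending at
  -- height `-1`; such a path has weight zero by `height_nonneg`.
  have e4 : z t = 0 → G * siteWeight q (y t) (z t + 1) (a t) (H t)
      * ∏ x ∈ Finset.Ico (t + 1) m, A x = 0 := by
    intro hzt
    have h0 : pathWeight q y (fun x => z x + if x = t then 1 else 0) a m = 0 := by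
      by_contra hne
      have := height_nonneg hy ha (fun x hx hy0 ha1 => ?_) hne
      · omega
      · have := hc x hx
        have := hb x
        omega
    have h1 : pathWeight q y (fun x => z x + if x = t then 1 else 0) a m
        = G * siteWeight q (y t) (z t + 1) (a t) (H t)
          * ∏ x ∈ Finset.Ico (t + 1) m, siteWeight q (y x) (z x) (a x) (H x - 1) := by
      rw [pathWeight, prod_range_split htm]
      congr 1
      · congr 1
        · refine Finset.prod_congr rfl fun x hx => ?_
          have hx' := Finset.mem_range.mp hx
          simp [hH, hx'.ne, hx'.not_gt]
        · simp [hH]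
      · refine Finset.prod_congr rfl fun x hx => ?_
        obtain ⟨h1, h2⟩ := hgt x hx
        simp [hH, h1, h2]
    rw [hA, Finset.prod_mul_distrib, mul_left_comm, ← h1, h0, mul_zero]
  have e5 : ∏ x ∈ Finset.range t, (-q) ^ y x = Q * (-q) ^ H t := by
    rw [hQ, prod_zpow _ _ hp, prod_zpow _ _ hp, ← zpow_add₀ hp, hHt, height, Finset.sum_sub_distrib]
    congr 1
    ring
  have hsum : ∑ u ∈ Finset.Ico (t + 1) m, (∏ x ∈ Finset.Ico (t + 1) u, A x)
        * (if a u = 1 ∧ z u = 1 then -qHat q * siteWeight q (y u) 0 0 (H u - 1) else 0)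
        * ∏ x ∈ Finset.Ico (u + 1) m, B x
      = (-q) ^ (H (t + 1) - 1) * ∏ x ∈ Finset.Ico (t + 1) m, B x
        - (-q) ^ (H m - 1) * ∏ x ∈ Finset.Ico (t + 1) m, A x := by
    refine sum_telescope A B _ (fun x => (-q) ^ (H x - 1)) (t + 1) m htm fun x h1 h2 => ?_
    have h1 : t < x := h1
    have h3 : H (x + 1) = H x + (y x - a x) := by
      simp only [hH, height_succ, if_pos h1, if_pos (h1.trans x.lt_succ_self)]
      ring
    have h4 := hc x h2
    rw [if_neg h1.ne', add_zero] at h4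
    rw [h3]
    exact siteWeight_exchange hq (H x) (hy x) (hz x) (ha x) (hb x) h4
  have e6 : ∑ u ∈ Finset.Ico (t + 1) m, (if z t = 0 ∧ a u = 1 ∧ z u = 1 then
          (∏ x ∈ Finset.range u, (-q) ^ a x) *
            ((-qHat q * ∏ x ∈ Finset.Ico (t + 1) u, (-q) ^ z x)
              * pathWeight q y (fun x => (z x + if x = t then 1 else 0) - if x = u then 1 else 0)
                (fun x => a x - if x = u then 1 else 0) m) else 0)
      = (if z t = 0 then Q * (-q) ^ a t * (G * siteWeight q (y t) (z t + 1) (a t) (H t)) else 0)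
        * ∑ u ∈ Finset.Ico (t + 1) m, (∏ x ∈ Finset.Ico (t + 1) u, A x)
        * (if a u = 1 ∧ z u = 1 then -qHat q * siteWeight q (y u) 0 0 (H u - 1) else 0)
        * ∏ x ∈ Finset.Ico (u + 1) m, B x := by
    rw [Finset.mul_sum]
    refine Finset.sum_congr rfl fun u hu => ?_
    by_cases h0 : z t = 0
    swap
    · rw [if_neg (fun h => h0 h.1), if_neg h0, zero_mul]
    by_cases h1 : a u = 1 ∧ z u = 1
    swap
    · rw [if_neg (fun h => h1 h.2), if_neg h1, mul_zero, zero_mul, mul_zero]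
    rw [if_pos ⟨h0, h1⟩, if_pos h0, if_pos h1, e3 u hu, prod_range_split (hgt u hu).2, hA,
      Finset.prod_mul_distrib, Finset.prod_mul_distrib, h1.1, h1.2, sub_self]
    ring
  have h3 : H (t + 1) = H t + (y t + 1 - a t) := by
    simp only [hH, height_succ]
    simp
    ring
  have h4 := hc t htm
  rw [if_pos rfl] at h4
  have hs := siteWeight_start hq (H t) (hy t) (hz t) (ha t) (hb t) h4
  rw [e1, e2, e5, e6, hsum, h3]
  have l1 : (if y t = 0 then Q * (-q) ^ H t * (G * siteWeight q (y t + 1) (z t) (a t) (H t)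
        * ∏ x ∈ Finset.Ico (t + 1) m, B x) else 0)
      = Q * G * (∏ x ∈ Finset.Ico (t + 1) m, B x)
        * (if y t = 0 then (-q) ^ H t * siteWeight q 1 (z t) (a t) (H t) else 0) := by
    split_ifs with h
    · rw [h, zero_add]; ring
    · ring
  have l2 : (if a t = 1 then Q * ((if z t = 1 then q⁻¹ else 1)
        * (G * siteWeight q (y t) (z t) (a t - 1) (H t)
          * ∏ x ∈ Finset.Ico (t + 1) m, B x)) else 0)
      = Q * G * (∏ x ∈ Finset.Ico (t + 1) m, B x) * (if a t = 1 then
        (if z t = 1 then q⁻¹ else 1) * siteWeight q (y t) (z t) 0 (H t) else 0) := by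
    by_cases h : a t = 1
    · rw [if_pos h, if_pos h, h, sub_self]; ring
    · rw [if_neg h, if_neg h]; ring
  rw [l1, l2, hs, mul_add, add_right_inj]
  by_cases h0 : z t = 0
  · have e4 := e4 h0
    rw [if_pos h0, if_pos h0]
    rw [h0, zero_add] at e4 ⊢
    linear_combination (Q * (-q) ^ a t * (-q) ^ (H m - 1)) * e4
  · rw [if_neg h0, if_neg h0]; ring

/-! ### Compatibility of `minorBraid` with exterior multiplication. -/

theorem bit_eq_one_iff {T : Finset (Fin n)} {x : Fin n} : bit T x = 1 ↔ x ∈ T := by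
  rw [bit_coe]; split_ifs with h <;> simp [h]

theorem bit_eq_zero_iff {T : Finset (Fin n)} {x : Fin n} : bit T x = 0 ↔ x ∉ T := by
  rw [bit_coe]; split_ifs with h <;> simp [h]

theorem sum_vecBraid_eq (u t : Fin n) (T : Finset (Fin n)) (f : Finset (Fin n) → k) :
    ∑ V, vecBraid q u V t T * f V
      = if u = t then (if t ∈ T then q⁻¹ else 1) * f T
        else if t < u ∧ t ∉ T ∧ u ∈ T then
          -qHat q * (-q) ^ between T t u * f (insert t (T.erase u)) else 0 := by
  unfold vecBraid
  split_ifs with h1 h2 h3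
  · simp
  · simp
  · obtain ⟨a, b, c⟩ := h3
    simp [a, b, c]
  · refine Finset.sum_eq_zero fun W _ => ?_
    rw [if_neg (fun h => h3 ⟨h.1, h.2.1, h.2.2.1⟩), zero_mul]

theorem minorBraid_eq_pathWeight {S S' J N : Finset (Fin n)}
    (h : ∀ x : Fin n, bit J x + bit N x = bit S x + bit S' x) (hc : S.card = J.card) :
    minorBraid q S S' J N = pathWeight q (bit J) (bit N) (bit S) n := if_pos ⟨h, hc⟩

/-- Braiding `e_t e_S` with `e_T` amounts to braiding `e_S` and `e_t` with it one after the other.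
The main induction uses this once on the row side and once, reversed, on the column side. -/
theorem minorBraid_mulCoeff (hq : q ≠ 0) (I M T S : Finset (Fin n)) (t : Fin n) :
    ∑ K, mulCoeff q K t S * minorBraid q I M K T
      = ∑ u, ∑ V, vecBraid q u V t T * ∑ U, mulCoeff q I u U * minorBraid q U M S V := by
  have hL := sum_mulCoeff_left (q := q) t S fun K => minorBraid q I M K T
  have hR : ∑ u, ∑ V, vecBraid q u V t T * ∑ U, mulCoeff q I u U * minorBraid q U M S V
      = ∑ u ∈ I, (-q) ^ below I u * ∑ V, vecBraid q u V t T * minorBraid q (I.erase u) M S V := by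
    have h := sum_mulCoeff (q := q) I
      fun u U => ∑ V, vecBraid q u V t T * minorBraid q U M S V
    simp only [smul_eq_mul] at h
    rw [← h]
    refine Finset.sum_congr rfl fun u _ => ?_
    simp only [Finset.mul_sum]
    rw [Finset.sum_comm]
    exact Finset.sum_congr rfl fun U _ => Finset.sum_congr rfl fun V _ => by ring
  simp only [smul_eq_mul] at hL
  rw [hL, hR]
  simp only [sum_vecBraid_eq]
  -- Unless `S`, `t`, `T` together have the same content as `I`, `M`, with matching sizes, every
  -- term on both sides is zero.
  by_cases hC : (∀ x : Fin n, bit S x + (if x = t then 1 else 0) + bit T x = bit I x + bit M x)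
      ∧ I.card = S.card + 1
  swap
  · have h1 : t ∉ S → minorBraid q I M (insert t S) T = 0 := by
      intro ht
      refine if_neg fun h => hC ⟨fun x => ?_, ?_⟩
      · have := h.1 x
        rw [bit_insert ht] at this
        simpa only [Fin.val_inj] using this
      · rw [h.2, Finset.card_insert_of_notMem ht]
    have h2 : ∀ u ∈ I, minorBraid q (I.erase u) M S T = 0 ∨ u ≠ t := by
      intro u hu
      by_cases hut : u = t
      swap
      · exact Or.inr hut
      subst hut
      refine Or.inl (if_neg fun h => hC ⟨fun x => ?_, ?_⟩)
      · have := h.1 x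
        rw [bit_erase hu] at this
        simp only [Fin.val_inj] at this
        omega
      · have := Finset.card_erase_add_one hu
        omega
    have h3 : ∀ u ∈ I, t < u ∧ t ∉ T ∧ u ∈ T →
        minorBraid q (I.erase u) M S (insert t (T.erase u)) = 0 := by
      rintro u hu ⟨htu, ht, huT⟩
      refine if_neg fun h => hC ⟨fun x => ?_, ?_⟩
      · have := h.1 x
        rw [bit_erase hu, bit_insert (fun h => ht (Finset.mem_of_mem_erase h)), bit_erase huT] at this
        simp only [Fin.val_inj] at this
        omega
      · have := Finset.card_erase_add_one hu
        omega
    rw [Finset.sum_eq_zero]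
    · split_ifs with ht
      · rfl
      · rw [h1 ht, mul_zero]
    · intro u hu
      split_ifs with h4 h5 h5
      · rw [(h2 u hu).resolve_right (fun h => h h4)]; ring
      · rw [(h2 u hu).resolve_right (fun h => h h4)]; ring
      · rw [h3 u hu h5]; ring
      · ring
  obtain ⟨hC1, hC2⟩ := hC
  have hc : ∀ x < n, bit S x + (if x = (t : ℕ) then 1 else 0) + bit T x = bit I x + bit M x := by
    intro x hx
    have := hC1 ⟨x, hx⟩
    simpa only [Fin.ext_iff] using this
  have hm : height (bit S) (bit I) n = -1 := by
    rw [height, Finset.sum_sub_distrib, sum_range_bit, sum_range_bit, hC2]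
    push_cast
    ring
  have key := pathWeight_exchange hq t.2 (bit_eq_zero_or_one S) (bit_eq_zero_or_one T)
    (bit_eq_zero_or_one I) (bit_eq_zero_or_one M) hc hm
  have hS : t ∉ S → (bit (insert t S)) = fun x => bit S x + if x = (t : ℕ) then 1 else 0 :=
    fun ht => funext (bit_insert ht)
  have hI : ∀ u ∈ I, bit (I.erase u) = fun x => bit I x - if x = (u : ℕ) then 1 else 0 :=
    fun u hu => funext (bit_erase hu)
  have hT : ∀ u ∈ T, t ∉ T → u ≠ t → bit (insert t (T.erase u))
      = fun x => (bit T x + if x = (t : ℕ) then 1 else 0) - if x = (u : ℕ) then 1 else 0 := by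
    intro u hu ht hut
    funext x
    rw [bit_insert (fun h => ht (Finset.mem_of_mem_erase h)), bit_erase hu]
    ring
  have hl : (if t ∈ S then 0 else (-q) ^ below S t * minorBraid q I M (insert t S) T)
      = if bit S t = 0 then (∏ x ∈ Finset.range t, (-q) ^ bit S x)
        * pathWeight q (fun x => bit S x + if x = (t : ℕ) then 1 else 0) (bit T) (bit I) n
        else 0 := by
    by_cases ht : t ∈ S
    · rw [if_pos ht, if_neg (fun h => bit_eq_zero_iff.mp h ht)]
    · have hb : minorBraid q I M (insert t S) T
          = pathWeight q (bit (insert t S)) (bit T) (bit I) n := by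
        refine minorBraid_eq_pathWeight (fun x => ?_) ?_
        · rw [hS ht]
          exact hc x x.2
        · rw [hC2, Finset.card_insert_of_notMem ht]
      rw [if_neg ht, if_pos (bit_eq_zero_iff.mpr ht), pow_below hq, hb, hS ht]
  rw [hl, key]
  -- `F` merges the diagonal term and the terms `u > t` of `pathWeight_exchange` into one function
  -- on all sites, to be compared with the sum over `u ∈ I`.
  set F : ℕ → k := fun u => if u < t then 0 else if u = t then
      (if bit I t = 1 then (∏ x ∈ Finset.range t, (-q) ^ bit I x) * ((if bit T t = 1 then q⁻¹ else 1)
          * pathWeight q (bit S) (bit T) (fun x => bit I x - if x = (t : ℕ) then 1 else 0) n) else 0)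
      else if bit T t = 0 ∧ bit I u = 1 ∧ bit T u = 1 then
          (∏ x ∈ Finset.range u, (-q) ^ bit I x) *
            ((-qHat q * ∏ x ∈ Finset.Ico ((t : ℕ) + 1) u, (-q) ^ bit T x)
              * pathWeight q (bit S)
                (fun x => (bit T x + if x = (t : ℕ) then 1 else 0) - if x = u then 1 else 0)
                (fun x => bit I x - if x = u then 1 else 0) n) else 0 with hF
  have hFsum : ∑ u : Fin n, F u = F t + ∑ u ∈ Finset.Ico ((t : ℕ) + 1) n, F u := by
    rw [Fin.sum_univ_eq_sum_range, ← Finset.sum_range_add_sum_Ico F (Nat.succ_le_of_lt t.2),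
      Finset.sum_range_succ, Finset.sum_eq_zero, zero_add]
    intro x hx
    rw [hF]
    exact if_pos (Finset.mem_range.mp hx)
  have hFt : F t = (if bit I t = 1 then (∏ x ∈ Finset.range t, (-q) ^ bit I x) *
      ((if bit T t = 1 then q⁻¹ else 1)
        * pathWeight q (bit S) (bit T) (fun x => bit I x - if x = (t : ℕ) then 1 else 0) n)
      else 0) := by
    rw [hF]
    simp
  have hFu : ∀ u ∈ Finset.Ico ((t : ℕ) + 1) n, F u
      = if bit T t = 0 ∧ bit I u = 1 ∧ bit T u = 1 then
          (∏ x ∈ Finset.range u, (-q) ^ bit I x) *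
            ((-qHat q * ∏ x ∈ Finset.Ico ((t : ℕ) + 1) u, (-q) ^ bit T x)
              * pathWeight q (bit S)
                (fun x => (bit T x + if x = (t : ℕ) then 1 else 0) - if x = u then 1 else 0)
                (fun x => bit I x - if x = u then 1 else 0) n) else 0 := by
    intro u hu
    have htu : (t : ℕ) < u := (Finset.mem_Ico.mp hu).1
    rw [hF]
    dsimp only
    rw [if_neg htu.not_gt, if_neg htu.ne']
  rw [← hFt, ← Finset.sum_congr rfl hFu, ← hFsum, ← Finset.sum_subset (Finset.subset_univ I)]
  · refine Finset.sum_congr rfl fun u hu => ?_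
    have hu1 : bit I u = 1 := bit_eq_one_iff.mpr hu
    rcases lt_trichotomy u t with hut | rfl | hut
    · rw [if_neg hut.ne, if_neg (fun h => hut.not_gt h.1), mul_zero, hF]
      exact if_pos hut
    · have hb : minorBraid q (I.erase u) M S T
          = pathWeight q (bit S) (bit T) (bit (I.erase u)) n := by
        refine minorBraid_eq_pathWeight (fun x => ?_) ?_
        · rw [hI u hu]
          have := hc x x.2
          dsimp only
          omega
        · have := Finset.card_erase_add_one hu
          omega
      rw [hFt, if_pos hu1, if_pos rfl, pow_below hq, hb, hI u hu]
      simp only [bit_eq_one_iff]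
    · rw [hFu u (Finset.mem_Ico.mpr ⟨hut, u.2⟩), if_neg hut.ne']
      by_cases h : t ∉ T ∧ u ∈ T
      · have hb : minorBraid q (I.erase u) M S (insert t (T.erase u))
            = pathWeight q (bit S) (bit (insert t (T.erase u))) (bit (I.erase u)) n := by
          refine minorBraid_eq_pathWeight (fun x => ?_) ?_
          · rw [hI u hu, hT u h.2 h.1 hut.ne']
            have := hc x x.2
            dsimp only
            omega
          · have := Finset.card_erase_add_one hu
            omega
        rw [if_pos ⟨bit_eq_zero_iff.mpr h.1, hu1, bit_eq_one_iff.mpr h.2⟩, if_pos ⟨hut, h⟩,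
          pow_below hq, pow_between hq, hb, hI u hu, hT u h.2 h.1 hut.ne']
      · rw [if_neg (fun h' => h ⟨bit_eq_zero_iff.mp h'.1, bit_eq_one_iff.mp h'.2.2⟩),
          if_neg (fun h' : t < u ∧ _ => h h'.2), mul_zero]
  · intro u _ hu
    have hu1 : bit I u ≠ 1 := fun h => hu (bit_eq_one_iff.mp h)
    rw [hF]
    dsimp only
    rw [if_neg (fun h : bit T t = 0 ∧ _ => hu1 h.2.1)]
    refine ite_eq_left_iff.mpr fun _ => ite_eq_right_iff.mpr fun h => ?_
    rw [← h, if_neg hu1]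

/-! ### Commuting two minors. -/

theorem minorBraid_empty (S S' N : Finset (Fin n)) :
    minorBraid q S S' ∅ N = if S = ∅ ∧ S' = N then 1 else 0 := by
  have h0 : ∀ x, bit (∅ : Finset (Fin n)) x = 0 := fun x => by simp [bit]
  split_ifs with h
  · obtain ⟨rfl, rfl⟩ := h
    rw [minorBraid_eq_pathWeight (fun x => rfl) rfl, pathWeight]
    refine Finset.prod_eq_one fun x _ => ?_
    have hh : height (bit (∅ : Finset (Fin n))) (bit (∅ : Finset (Fin n))) x = 0 := by
      simp [height]
    rw [hh, h0]
    rcases bit_eq_zero_or_one S' x with h | h <;> rw [h] <;> simp [siteWeight]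
  · refine if_neg fun h' => h ?_
    have hS : S = ∅ := Finset.card_eq_zero.mp (h'.2.trans Finset.card_empty)
    subst hS
    refine ⟨rfl, ?_⟩
    ext x
    have := h'.1 x
    rw [← bit_eq_one_iff, ← bit_eq_one_iff (T := N)]
    omega

/-- Commutation of two minors, with all coefficients. -/
theorem minorBraid_minor_minor (hq : q ≠ 0) (J I M N : Finset (Fin n)) :
    ∑ S, ∑ S', minorBraid q S S' J N • (minor q I S * minor q M S')
      = ∑ T, ∑ T', minorBraid q I M T T' • (minor q T' N * minor q T J) := by
  induction J using Finset.induction_on_min generalizing I M N with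
  | empty =>
    simp [minorBraid_empty, minor_empty_right, ite_and]
  | insert i J hi ih =>
    symm
    simp only [minor_insert_eq_sum_mulCoeff hi]
    -- The generator in the least column `i` passes the minor on `N` by `vecBraid_minor_gen`, and
    -- the remaining columns `J` pass by induction.
    calc
      _ = ∑ T', ∑ t, ∑ S, (∑ T, mulCoeff q T t S * minorBraid q I M T T') •
            (minor q T' N * (gen q t i * minor q S J)) := by
        simp only [Finset.mul_sum, Finset.smul_sum, Finset.sum_smul, ← Fintype.sum_prod_type']
        refine Fintype.sum_equiv ⟨fun ⟨T, T', t, S⟩ => ⟨T', t, S, T⟩, fun ⟨T', t, S, T⟩ => ⟨T, T', t, S⟩,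
          fun _ => rfl, fun _ => rfl⟩ _ _ fun ⟨T, T', t, S⟩ => ?_
        simp only [Equiv.coe_fn_mk, mul_smul_comm, smul_smul, mul_comm]
      _ = ∑ u, ∑ U, mulCoeff q I u U • ∑ S, ∑ V, minorBraid q U M S V •
            ((∑ t, ∑ T', vecBraid q u V t T' • (minor q T' N * gen q t i)) * minor q S J) := by
        simp only [minorBraid_mulCoeff hq]
        simp only [Finset.mul_sum, Finset.sum_mul, Finset.smul_sum, Finset.sum_smul,
          ← Fintype.sum_prod_type']
        refine Fintype.sum_equiv ⟨fun ⟨T', t, S, u, V, U⟩ => ⟨u, U, S, V, t, T'⟩,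
          fun ⟨u, U, S, V, t, T'⟩ => ⟨T', t, S, u, V, U⟩,
          fun _ => rfl, fun _ => rfl⟩ _ _ fun ⟨T', t, S, u, V, U⟩ => ?_
        simp only [Equiv.coe_fn_mk, smul_mul_assoc, smul_smul, mul_assoc]
        congr 1
        ring
      _ = ∑ s, ∑ B, ∑ u, ∑ U, (mulCoeff q I u U * vecBraid q s B i N) • (gen q u s *
            ∑ S, ∑ V, minorBraid q U M S V • (minor q V B * minor q S J)) := by
        simp only [vecBraid_minor_gen hq]
        simp only [Finset.mul_sum, Finset.sum_mul, Finset.smul_sum, ← Fintype.sum_prod_type']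
        refine Fintype.sum_equiv ⟨fun ⟨u, U, S, V, s, B⟩ => ⟨s, B, u, U, S, V⟩,
          fun ⟨s, B, u, U, S, V⟩ => ⟨u, U, S, V, s, B⟩,
          fun _ => rfl, fun _ => rfl⟩ _ _ fun ⟨u, U, S, V, s, B⟩ => ?_
        simp only [Equiv.coe_fn_mk, smul_mul_assoc, mul_smul_comm, smul_smul, mul_assoc]
        congr 1
        ring
      _ = ∑ s, ∑ B, ∑ C, ∑ D, (vecBraid q s B i N * minorBraid q C D J B) •
            ((∑ u, ∑ U, mulCoeff q I u U • (gen q u s * minor q U C)) * minor q M D) := by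
        simp only [← ih]
        refine Finset.sum_congr rfl fun s _ => Finset.sum_congr rfl fun B _ => ?_
        simp only [Finset.mul_sum, Finset.sum_mul, Finset.smul_sum, ← Fintype.sum_prod_type']
        refine Fintype.sum_equiv ⟨fun ⟨u, U, C, D⟩ => ⟨C, D, u, U⟩,
          fun ⟨C, D, u, U⟩ => ⟨u, U, C, D⟩,
          fun _ => rfl, fun _ => rfl⟩ _ _ fun ⟨u, U, C, D⟩ => ?_
        simp only [Equiv.coe_fn_mk, smul_mul_assoc, mul_smul_comm, smul_smul, mul_assoc]
        congr 1
        ring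
      _ = ∑ K, ∑ D, (∑ s, ∑ B, vecBraid q s B i N * ∑ C, mulCoeff q K s C * minorBraid q C D J B) •
            (minor q I K * minor q M D) := by
        simp only [sum_mulCoeff_minor hq]
        simp only [Finset.mul_sum, Finset.sum_mul, Finset.smul_sum, Finset.sum_smul,
          ← Fintype.sum_prod_type']
        refine Fintype.sum_equiv ⟨fun ⟨s, B, C, D, K⟩ => ⟨K, D, s, B, C⟩,
          fun ⟨K, D, s, B, C⟩ => ⟨s, B, C, D, K⟩,
          fun _ => rfl, fun _ => rfl⟩ _ _ fun ⟨s, B, C, D, K⟩ => ?_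
        simp only [Equiv.coe_fn_mk, smul_mul_assoc, smul_smul]
        congr 1
        ring
      _ = _ := by
        simp only [← minorBraid_mulCoeff hq]
        refine Finset.sum_congr rfl fun K _ => Finset.sum_congr rfl fun D _ => ?_
        have h := sum_mulCoeff_min (q := q) hi fun X => minorBraid q K D X N
        simp only [smul_eq_mul] at h
        rw [h]

/-! ### Identification of the path weights with `muTilde` and `lambdaTilde`. -/

theorem neg_qHat_mul_negQInt (hq : q ≠ 0) (d : ℕ) :
    -qHat q * negQInt q d = (-q) ^ (d : ℤ) - (-q) ^ (-(d : ℤ)) := by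
  obtain ⟨p, rfl⟩ : ∃ p, q = -p := ⟨-q, (neg_neg q).symm⟩
  have hp : p ≠ 0 := neg_ne_zero.mp hq
  have h : ∀ i : ℕ, -qHat (-p) * p ^ ((d : ℤ) - 1 - 2 * (i : ℤ))
      = p ^ ((d : ℤ) - 2 * (i : ℤ)) - p ^ ((d : ℤ) - 2 * ((i + 1 : ℕ) : ℤ)) := by
    intro i
    have e1 : (d : ℤ) - 2 * (i : ℤ) = ((d : ℤ) - 1 - 2 * (i : ℤ)) + 1 := by ring
    have e2 : (d : ℤ) - 2 * ((i + 1 : ℕ) : ℤ) = ((d : ℤ) - 1 - 2 * (i : ℤ)) - 1 := by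
      push_cast; ring
    rw [e1, e2, zpow_add_one₀ hp, zpow_sub_one₀ hp, qHat]
    field_simp
    ring
  rw [negQInt, Finset.mul_sum]
  simp only [neg_neg]
  rw [Finset.sum_congr rfl fun i _ => h i,
    Finset.sum_range_sub' fun i : ℕ => p ^ ((d : ℤ) - 2 * (i : ℤ))]
  congr 2 <;> ring_nf

theorem sum_range_bit_coe (T : Finset (Fin n)) (x : Fin n) :
    ∑ y ∈ Finset.range x, bit T y = below T x := by
  rw [sum_bit]
  simp [below]

theorem height_bit (J S : Finset (Fin n)) (x : Fin n) :
    height (bit J) (bit S) x = (below (J \ S) x : ℤ) - below (S \ J) x := by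
  have h : ∀ A B : Finset (Fin n), below A x = below (A \ B) x + below (A ∩ B) x := by
    intro A B
    unfold below
    rw [← Finset.card_union_of_disjoint, ← Finset.filter_union, Finset.sdiff_union_inter]
    exact Finset.disjoint_filter_filter (Finset.disjoint_sdiff_inter A B)
  rw [height, Finset.sum_sub_distrib, sum_range_bit_coe, sum_range_bit_coe, h J S, h S J,
    Finset.inter_comm S J]
  push_cast
  ring

theorem ell_eq_sum (S T : Finset (Fin n)) : ell S T = ∑ x ∈ S, below T x := by
  unfold ell below
  rw [Finset.card_filter, Finset.sum_product]
  exact Finset.sum_congr rfl fun x _ => (Finset.card_filter _ _).symm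

theorem height_nonneg_of_pathWeight_ne_zero {J N S : Finset (Fin n)} (hS : S ⊆ J ∪ N)
    (h : pathWeight q (bit J) (bit N) (bit S) n ≠ 0) {m : ℕ} (hm : m ≤ n) :
    0 ≤ height (bit J) (bit S) m := by
  refine height_nonneg (q := q) (z := bit N) (bit_eq_zero_or_one J) (bit_eq_zero_or_one S)
    (fun x hx h0 h1 h2 => ?_) fun h0 => h ?_
  · have hx' := hx.trans_le hm
    have e0 := (bit_eq_zero_iff (x := ⟨x, hx'⟩)).mp h0
    have e1 := (bit_eq_one_iff (x := ⟨x, hx'⟩)).mp h1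
    have e2 := (bit_eq_zero_iff (x := ⟨x, hx'⟩)).mp h2
    rcases Finset.mem_union.mp (hS e1) with h | h
    · exact e0 h
    · exact e2 h
  · rw [pathWeight, ← Finset.prod_range_mul_prod_Ico _ hm, ← pathWeight, h0, zero_mul]

/-- If the element of `S` at position `l` (counted from zero) were smaller than that of `J`, then
just past it there would be at least `l + 1` down-steps and at most `l` up-steps, so the path would
lie below the axis. -/
theorem indexLE_of_pathWeight_ne_zero {J N S : Finset (Fin n)} (hS : S ⊆ J ∪ N)
    (hc : J.card = S.card) (h : pathWeight q (bit J) (bit N) (bit S) n ≠ 0) : IndexLE J S := by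
  refine ⟨hc, fun l => ?_⟩
  by_contra! hlt
  set s := S.orderEmbOfFin rfl l with hs
  have h1 := height_nonneg_of_pathWeight_ne_zero hS h (m := (s : ℕ) + 1) s.2
  rw [height, Finset.sum_sub_distrib, sum_bit, sum_bit] at h1
  have h2 : (l : ℕ) + 1 ≤ (S.filter fun y : Fin n => (y : ℕ) ∈ Finset.range (s + 1)).card := by
    rw [← Fin.card_Iic]
    refine Finset.card_le_card_of_injOn (S.orderEmbOfFin rfl) ?_ ?_
    · intro x hx
      have hx' : x ≤ l := by simpa using hx
      have : S.orderEmbOfFin rfl x ≤ s := (S.orderEmbOfFin rfl).monotone hx'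
      simp [this]
    · exact (S.orderEmbOfFin rfl).injective.injOn
  have h3 : (J.filter fun y : Fin n => (y : ℕ) ∈ Finset.range (s + 1)).card ≤ l := by
    rw [← Fin.card_Iio l, ← Finset.card_image_of_injective (Finset.Iio l) (J.orderEmbOfFin hc).injective]
    refine Finset.card_le_card fun y hy => ?_
    obtain ⟨hyJ, hy⟩ := Finset.mem_filter.mp hy
    have hys : y ≤ s := Nat.lt_succ_iff.mp (Finset.mem_range.mp hy)
    rw [← Finset.mem_coe, ← Finset.range_orderEmbOfFin J hc] at hyJ
    obtain ⟨x, rfl⟩ := hyJ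
    refine Finset.mem_image_of_mem _ (Finset.mem_Iio.mpr ?_)
    exact (J.orderEmbOfFin hc).lt_iff_lt.mp (hys.trans_lt hlt)
  omega

/-- The sites of `J ∩ N` give the powers of `q⁻¹`, and those of `S \ J` are the down-steps. The
other sites of `J ∪ N` form `G`, and their heights add up to `-𝓛^♮`. -/
theorem pathWeight_eq_prod (hq : q ≠ 0) {J N S : Finset (Fin n)} (h1 : S ⊆ J ∪ N)
    (h2 : J ∩ N ⊆ S) :
    pathWeight q (bit J) (bit N) (bit S) n
      = q⁻¹ ^ (J ∩ N).card * (∏ x ∈ S \ J, ((-q) ^ height (bit J) (bit S) x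
          - (-q) ^ (-height (bit J) (bit S) x))) * (-q) ^ (-expLNat S J N) := by
  set G := (natural J N S \ S) ∪ (J \ N) with hG
  have hexp : -expLNat S J N = ∑ x ∈ G, height (bit J) (bit S) x := by
    simp only [height_bit, expLNat, ← hG, ell_eq_sum, Finset.sum_sub_distrib]
    push_cast
    ring
  have hsite : ∀ x : Fin n, siteWeight q (bit J x) (bit N x) (bit S x) (height (bit J) (bit S) x)
      = (if x ∈ J ∩ N then q⁻¹ else 1) * (if x ∈ S \ J then ((-q) ^ height (bit J) (bit S) x
          - (-q) ^ (-height (bit J) (bit S) x)) else 1)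
        * (if x ∈ G then (-q) ^ height (bit J) (bit S) x else 1) := by
    intro x
    have h1x := @h1 x
    have h2x := @h2 x
    simp only [bit_coe, hG, natural, Finset.mem_union, Finset.mem_inter, Finset.mem_sdiff] at *
    by_cases hJ : x ∈ J <;> by_cases hN : x ∈ N <;> by_cases hS : x ∈ S <;>
      simp [hJ, hN, hS, siteWeight] at h1x h2x ⊢
  rw [pathWeight, ← Fin.prod_univ_eq_prod_range
    (fun x => siteWeight q (bit J x) (bit N x) (bit S x) (height (bit J) (bit S) x)), hexp,
    ← prod_zpow _ _ (neg_ne_zero.mpr hq)]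
  simp only [hsite, Finset.prod_mul_distrib, Finset.prod_ite_mem, Finset.univ_inter,
    Finset.prod_const]

theorem pow_mul_pathWeight (hq : q ≠ 0) {J N S : Finset (Fin n)} (h1 : S ⊆ J ∪ N)
    (h2 : J ∩ N ⊆ S) :
    q ^ (J ∩ N).card * pathWeight q (bit J) (bit N) (bit S) n = muTilde q J N S := by
  have hfilter : ∀ r ∈ S \ J, (((J \ S).filter fun j => j ≤ r).card
      - ((S \ J).filter fun i => i < r).card : ℕ) = (height (bit J) (bit S) r).toNat := by
    intro r hr
    -- Since `r ∉ J \ S`, the number `d_l` in `xi` is exactly the height at `r`.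
    have : ((J \ S).filter fun j => j ≤ r) = (J \ S).filter fun j => j < r := by
      refine Finset.filter_congr fun j hj => ⟨fun h => lt_of_le_of_ne h ?_, le_of_lt⟩
      rintro rfl
      exact (Finset.mem_sdiff.mp hr).2 (Finset.mem_sdiff.mp hj).1
    rw [this, height_bit, ← below, ← below]
    omega
  by_cases hpos : ∀ r ∈ S \ J, 0 ≤ height (bit J) (bit S) r
  · have hD : ∏ x ∈ S \ J, ((-q) ^ height (bit J) (bit S) x - (-q) ^ (-height (bit J) (bit S) x))
        = (-qHat q) ^ (S \ J).card * xi q (S \ J) (J \ S) := by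
      rw [xi, ← Finset.prod_const, ← Finset.prod_mul_distrib]
      refine Finset.prod_congr rfl fun r hr => ?_
      rw [hfilter r hr, neg_qHat_mul_negQInt hq, Int.toNat_of_nonneg (hpos r hr)]
    rw [pathWeight_eq_prod hq h1 h2, hD, muTilde, ← mul_assoc, ← mul_assoc, ← mul_pow,
      mul_inv_cancel₀ hq, one_pow, one_mul, mul_right_comm]
  -- At a negative height the truncated subtraction in `xi` gives `d = 0`, and `negQInt q 0` is an
  -- empty sum; so both sides vanish.
  · push Not at hpos
    obtain ⟨r, hr, hneg⟩ := hpos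
    have hp : pathWeight q (bit J) (bit N) (bit S) n = 0 := by
      by_contra h
      exact absurd (height_nonneg_of_pathWeight_ne_zero h1 h r.2.le) hneg.not_ge
    rw [hp, mul_zero, muTilde, xi, Finset.prod_eq_zero hr, mul_zero]
    rw [hfilter r hr, Int.toNat_of_nonpos hneg.le]
    simp [negQInt]

theorem bit_add_bit_iff {J N S S' : Finset (Fin n)} :
    (∀ x : Fin n, bit J x + bit N x = bit S x + bit S' x)
      ↔ (S ⊆ J ∪ N ∧ J ∩ N ⊆ S) ∧ S' = natural J N S := by
  have hx : ∀ x : Fin n, bit J x + bit N x = bit S x + bit S' x ↔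
      ((x ∈ S → x ∈ J ∪ N) ∧ (x ∈ J ∩ N → x ∈ S)) ∧ (x ∈ S' ↔ x ∈ natural J N S) := by
    intro x
    simp only [bit_coe, natural, Finset.mem_union, Finset.mem_inter, Finset.mem_sdiff]
    by_cases hJ : x ∈ J <;> by_cases hN : x ∈ N <;> by_cases hS : x ∈ S <;>
      by_cases hS' : x ∈ S' <;> simp [hJ, hN, hS, hS']
  simp only [hx, forall_and, Finset.ext_iff]
  rfl

theorem natural_self (J N : Finset (Fin n)) : natural J N J = N := by
  ext x
  simp only [natural, Finset.mem_union, Finset.mem_inter, Finset.mem_sdiff]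
  tauto

theorem muTilde_self (J N : Finset (Fin n)) : muTilde q J N J = 1 := by
  simp [muTilde, expLNat, ell, xi]

theorem minorBraid_eq (S S' J N : Finset (Fin n)) : minorBraid q S S' J N
    = if ((S ⊆ J ∪ N ∧ J ∩ N ⊆ S) ∧ S' = natural J N S) ∧ S.card = J.card then
      pathWeight q (bit J) (bit N) (bit S) n else 0 := by
  simp only [minorBraid, bit_add_bit_iff]

theorem pow_mul_minorBraid (hq : q ≠ 0) (S S' J N : Finset (Fin n)) :
    q ^ (J ∩ N).card * minorBraid q S S' J N
    = if S' = natural J N S then (if S = J then 1 else 0)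
      + (if S ∈ upperSets J N then muTilde q J N S else 0) else 0 := by
  rw [minorBraid_eq]
  by_cases hS' : S' = natural J N S
  swap
  · rw [if_neg (fun h => hS' h.1.2), if_neg hS', mul_zero]
  rw [if_pos hS']
  by_cases hSJ : S = J
  · subst hSJ
    have h1 : S ⊆ S ∪ N := Finset.subset_union_left
    have h2 : S ∩ N ⊆ S := Finset.inter_subset_left
    have h3 : S ∉ upperSets S N := fun h => by
      simp only [upperSets, Finset.mem_filter] at h
      exact h.2.2.2.2 rfl
    rw [if_pos ⟨⟨⟨h1, h2⟩, hS'⟩, rfl⟩, if_pos rfl, if_neg h3, add_zero, pow_mul_pathWeight hq h1 h2,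
      muTilde_self]
  rw [if_neg hSJ, zero_add]
  by_cases hv : ((S ⊆ J ∪ N ∧ J ∩ N ⊆ S) ∧ S' = natural J N S) ∧ S.card = J.card
  swap
  · rw [if_neg hv, mul_zero, if_neg]
    intro h
    simp only [upperSets, Finset.mem_filter, Finset.mem_powerset] at h
    exact hv ⟨⟨⟨h.1, h.2.1⟩, hS'⟩, h.2.2.1⟩
  rw [if_pos hv]
  obtain ⟨⟨⟨h1, h2⟩, -⟩, h3⟩ := hv
  split_ifs with hu
  · exact pow_mul_pathWeight hq h1 h2
  · by_cases h0 : pathWeight q (bit J) (bit N) (bit S) n = 0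
    · rw [h0, mul_zero]
    refine absurd ?_ hu
    simp only [upperSets, Finset.mem_filter, Finset.mem_powerset]
    exact ⟨h1, h2, h3, indexLE_of_pathWeight_ne_zero h1 h3.symm h0, Ne.symm hSJ⟩

/-- The relation between `(I, M)` and `(T, T')` is symmetric. This is why the row coefficients, in
which `T` plays the role of `J` and `I` that of `S`, follow from `pow_mul_minorBraid`. -/
theorem natural_swap {I M T T' : Finset (Fin n)}
    (h : ∀ x : Fin n, bit T x + bit T' x = bit I x + bit M x) :
    T' = natural I M T ∧ M = natural T T' I ∧ T ∩ T' = I ∩ M ∧ T ∪ T' = I ∪ M := by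
  refine ⟨(bit_add_bit_iff.mp fun x => (h x).symm).2, (bit_add_bit_iff.mp h).2, ?_, ?_⟩
  all_goals
    ext x
    have hx := h x
    simp only [bit_coe] at hx
    simp only [Finset.mem_inter, Finset.mem_union]
    by_cases hJ : x ∈ I <;> by_cases hN : x ∈ M <;> by_cases hS : x ∈ T <;>
      by_cases hS' : x ∈ T' <;> simp [hJ, hN, hS, hS'] at hx ⊢

theorem muTilde_eq_lambdaTilde {I M T T' : Finset (Fin n)} (h1 : T' = natural I M T)
    (h2 : M = natural T T' I) : muTilde q T T' I = lambdaTilde q I M T := by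
  rw [muTilde, lambdaTilde, expLNat, expL, ← h1, ← h2, Finset.union_comm (M \ I)]

theorem pow_mul_minorBraid' (hq : q ≠ 0) (I M T T' : Finset (Fin n)) :
    q ^ (I ∩ M).card * minorBraid q I M T T'
    = if T' = natural I M T then (if T = I then 1 else 0)
      + (if T ∈ lowerSets I M then lambdaTilde q I M T else 0) else 0 := by
  by_cases h : ∀ x : Fin n, bit T x + bit T' x = bit I x + bit M x
  · obtain ⟨e1, e2, e3, e4⟩ := natural_swap h
    have hmem : I ∈ upperSets T T' ↔ T ∈ lowerSets I M := by
      have h' := (bit_add_bit_iff.mp fun x => (h x).symm).1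
      have h'' := (bit_add_bit_iff.mp h).1
      simp only [upperSets, lowerSets, Finset.mem_filter, Finset.mem_powerset, h'.1, h'.2, h''.1,
        h''.2, true_and, eq_comm]
    rw [← e3, pow_mul_minorBraid hq, if_pos e2, if_pos e1, muTilde_eq_lambdaTilde e1 e2]
    simp only [hmem, eq_comm]
  · rw [minorBraid, if_neg (fun h' => h h'.1), mul_zero]
    by_cases hT' : T' = natural I M T
    swap
    · rw [if_neg hT']
    have hv : ¬ (T ⊆ I ∪ M ∧ I ∩ M ⊆ T) := fun hv =>
      h fun x => (bit_add_bit_iff.mpr ⟨hv, hT'⟩ x).symm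
    rw [if_pos hT', if_neg, if_neg, add_zero]
    · intro hT
      simp only [lowerSets, Finset.mem_filter, Finset.mem_powerset] at hT
      exact hv ⟨hT.1, hT.2.1⟩
    · rintro rfl
      exact hv ⟨Finset.subset_union_left, Finset.inter_subset_left⟩

end QuantumMatrices

theorem corollary5p7 {k : Type*} [Field k] (n : ℕ) (q : k) (hq : q ≠ 0)
    (I J M N : Finset (Fin n)) (hIJ : I.card = J.card) (hMN : M.card = N.card) :
    q ^ (I ∩ M).card • (QuantumMatrices.minor q I J * QuantumMatrices.minor q M N)
      + q ^ (I ∩ M).card • ∑ S ∈ QuantumMatrices.upperSets J N,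
          QuantumMatrices.muTilde q J N S •
            (QuantumMatrices.minor q I S *
              QuantumMatrices.minor q M (QuantumMatrices.natural J N S))
    = q ^ (J ∩ N).card • (QuantumMatrices.minor q M N * QuantumMatrices.minor q I J)
      + q ^ (J ∩ N).card • ∑ T ∈ QuantumMatrices.lowerSets I M,
          QuantumMatrices.lambdaTilde q I M T •
            (QuantumMatrices.minor q (QuantumMatrices.natural I M T) N *
              QuantumMatrices.minor q T J) := by
  open QuantumMatrices in
  have h := minorBraid_minor_minor hq J I M N
  have hl : q ^ (J ∩ N).card • ∑ S, ∑ S', minorBraid q S S' J N • (minor q I S * minor q M S')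
      = minor q I J * minor q M N + ∑ S ∈ upperSets J N, muTilde q J N S •
          (minor q I S * minor q M (natural J N S)) := by
    simp only [Finset.smul_sum, smul_smul, pow_mul_minorBraid hq, ite_smul, zero_smul,
      Finset.sum_ite_eq', Finset.mem_univ, if_true, add_smul, one_smul, Finset.sum_add_distrib,
      natural_self, Finset.sum_ite_mem, Finset.univ_inter]
  have hr : q ^ (I ∩ M).card • ∑ T, ∑ T', minorBraid q I M T T' • (minor q T' N * minor q T J)
      = minor q M N * minor q I J + ∑ T ∈ lowerSets I M, lambdaTilde q I M T •
          (minor q (natural I M T) N * minor q T J) := by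
    simp only [Finset.smul_sum, smul_smul, pow_mul_minorBraid' hq, ite_smul, zero_smul,
      Finset.sum_ite_eq', Finset.mem_univ, if_true, add_smul, one_smul, Finset.sum_add_distrib,
      natural_self, Finset.sum_ite_mem, Finset.univ_inter]
  -- Each side of the braiding relation absorbs its own power of `q` through `hl` or `hr`; the other
  -- power remains in front, so the two exponents appear crosswise.
  rw [← smul_add, ← smul_add, ← hl, ← hr, h, smul_comm]
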